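/- For an index $\mathbf k=(k_1,\dots,k_r)$ of positive integers put $$\overline T(k_1,\dots,k_r):=2^r\sum_{0<n_1<\cdots<n_r}\frac{(-1)^{n_r}}{(2n_1-1)^{k_1}(2n_2-2)^{k_2}\cdots(2n_r-r)^{k_r}},$$ where the series is the limit as $N\to\infty$ of its finite partial sums over $n_r\le N$, and let $$W(k,r):=\sum_{\substack{k_1+\cdots+k_r=k\\ k_1,\dots,k_r\ge 1}}\overline T(k_1,\dots,k_r).$$ For $k\geq 1$ let $\overline\zeta(k):=\sum_{n=1}^\infty (-1)^{n-1}/n^k$. For integers $1\le j\le p$ let $Z(p,p):=1$ and, if $j<p$, $$Z(j,p):=\sum_{k=1}^{p-j}(-2)^k\sum_{j=i_0<i_1<\cdots<i_{k-1}<i_k=p}\ \prod_{l=1}^k\overline\zeta(2i_l-2i_{l-1}).$$ Then for all positive integers $m$ and $p$, all the series $\overline T(\mathbf k)$ occurring below converge, and $$(-1)^m\sum_{j=1}^p W(2j+2m-3,2m-1)\,Z(j,p)=(-1)^p\sum_{j=1}^m W(2j+2p-3,2p-1)\,Z(j,m).$$ -/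

import Mathlib

open Filter Topology

namespace AltMTV

noncomputable section

/-- `I(k, r)`: the indices `(k_1, …, k_r)` of positive integers with `k_1 + ⋯ + k_r = k`.
The entry `k_j` is the value at `j - 1 : Fin r`. -/
def indices (k r : ℕ) : Finset (Fin r → ℕ) :=
  (Fintype.piFinset fun _ => Finset.Icc 1 k).filter fun κ => ∑ i, κ i = k

open Classical in
/-- The strictly increasing tuples `0 < n_1 < ⋯ < n_r ≤ N` of integers. -/
def increasingTuples (r N : ℕ) : Finset (Fin r → ℕ) :=
  (Fintype.piFinset fun _ => Finset.Icc 1 N).filter fun n => StrictMono n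

/-- The partial sum, over `0 < n_1 < ⋯ < n_r ≤ N`, of the series
`2^r ∑ (-1)^{n_r} / ((2 n_1 - 1)^{k_1} (2 n_2 - 2)^{k_2} ⋯ (2 n_r - r)^{k_r})`.
Only the last factor of the product carries the sign. -/
def barTPartial {r : ℕ} (κ : Fin r → ℕ) (N : ℕ) : ℝ :=
  2 ^ r * ∑ n ∈ increasingTuples r N,
    ∏ i : Fin r, (if (i : ℕ) + 1 = r then (-1 : ℝ) ^ n i else 1) /
      (2 * (n i : ℝ) - ((i : ℕ) + 1 : ℝ)) ^ κ i

/-- The alternating multiple `T`-value with a bar on the last entry only. The series converges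
only conditionally when `k_r = 1`, so it is summed in the order of increasing `n_r`. -/
def barT {r : ℕ} (κ : Fin r → ℕ) : ℝ :=
  limUnder atTop (barTPartial κ)

/-- `W(k, r)`: the sum of the alternating multiple `T`-values over all indices of weight `k` and
depth `r`. -/
def W (k r : ℕ) : ℝ :=
  ∑ κ ∈ indices k r, barT κ

/-- The `N`-th partial sum of `∑_{n ≥ 1} (-1)^{n-1} / n^k`. -/
def barZetaPartial (k N : ℕ) : ℝ :=
  ∑ n ∈ Finset.range N, (-1 : ℝ) ^ n / ((n : ℝ) + 1) ^ k

/-- The alternating Riemann zeta value `∑_{n ≥ 1} (-1)^{n-1} / n^k`, with value `1/2` at `k = 0`. -/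
def barZeta (k : ℕ) : ℝ :=
  if k = 0 then 1 / 2 else limUnder atTop (barZetaPartial k)

/-- The series defining `barZeta k` converges to it for every `k ≥ 1`. -/
theorem tendsto_barZetaPartial {k : ℕ} (hk : k ≠ 0) :
    Tendsto (barZetaPartial k) atTop (𝓝 (barZeta k)) := by
  have hanti : Antitone fun n : ℕ => 1 / ((n : ℝ) + 1) ^ k := by
    intro a b hab
    have : (a : ℝ) ≤ b := by exact_mod_cast hab
    dsimp only
    gcongr
  have hzero : Tendsto (fun n : ℕ => 1 / ((n : ℝ) + 1) ^ k) atTop (𝓝 0) := by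
    have h := (tendsto_one_div_add_atTop_nhds_zero_nat (𝕜 := ℝ)).pow k
    simpa [hk, div_pow] using h
  obtain ⟨l, hl⟩ := hanti.tendsto_alternating_series_of_tendsto_zero hzero
  have hl' : Tendsto (barZetaPartial k) atTop (𝓝 l) := by
    refine hl.congr fun N => ?_
    simp [barZetaPartial, div_eq_mul_inv]
  rw [barZeta, if_neg hk, hl'.limUnder_eq]
  exact hl'

open Classical in
/-- The strictly increasing chains `j = i_0 < i_1 < ⋯ < i_k = p` of integers. -/
def chains (j p k : ℕ) : Finset (Fin (k + 1) → ℕ) :=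
  (Fintype.piFinset fun _ => Finset.Icc j p).filter fun i =>
    StrictMono i ∧ i 0 = j ∧ i (Fin.last k) = p

/-- `Z(j, p)` for `1 ≤ j ≤ p`, with `Z(p, p) = 1`. -/
def Z (j p : ℕ) : ℝ :=
  if j = p then 1
  else ∑ k ∈ Finset.Icc 1 (p - j), (-2 : ℝ) ^ k *
    ∑ i ∈ chains j p k, ∏ l : Fin k, barZeta (2 * i l.succ - 2 * i l.castSucc)

end

end AltMTV

namespace AltMTV

noncomputable section

/-! Let gd u = arctan (sinh u) and F(x, y) = ∫_0^∞ cosh(xu) cos(y gd u) / cosh u du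
(`coshCosIntegral`). Both sides of the theorem are the coefficient of x^(2(p-1)) y^(2(m-1)) in one
function, sin(πx)/(πx) · F(x, y) = sin(πy)/(πy) · F(y, x), read off from its two expressions.

The factor Z(j, p) is the coefficient of x^(2(p-j)) in sin(πx)/(πx) (`Z_eq_sincCoeff`): summing over
chains inverts the power series 1 + 2 ∑ ζ̄(2n) x^(2n), which is πx / sin(πx) by Euler's evaluation
of ζ̄(2n) through Bernoulli polynomials at 1/2.

The factor W is a moment, W(r+1+e, r+1) = (-1)^(r+1) ∫ gd^r/r! · u^e/e! · du/cosh u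
(`W_eq_gdIntegral`). Weighting the terms of W by exp(-u(2n+1-r)) gives functions of u whose
derivatives combine the functions of smaller depth or weight, with 1/cosh u as coefficient
(`hasDerivAt_expSeries`). In generating-function form this is a first-order linear equation with
integrating factor exp(tu - s gd u); integrating from 0, where Abel's theorem gives W, to infinity
gives the moment. Up to sign, the moments of even order in gd and in u are the Taylor coefficients
of F.

The symmetry y sin(πx) F(x, y) = x sin(πy) F(y, x) (`coshCosIntegral_duality`) comes from Cauchy's
theorem for exp(xw)(tanh(w/2)^y - 1) on the half-strip 0 ≤ Im w ≤ π/2, Re w ≥ 0. On the top edge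
tanh(w/2) is exp(i(π/2 - gd u)), and on the left edge w = ib it is i tan(b/2). The substitution b =
π/2 - gd u turns tan(b/2) into exp(-u), so the edges carry the same kind of integral with x and y
exchanged. The sign changes of x and y then eliminate the sine integrals. -/

/-! ### Chains and the recursion for Z -/

/-- The contribution of the chains with `k` steps to `Z j p`, without the power of `-2`. -/
def chainSum (j p k : ℕ) : ℝ :=
  ∑ i ∈ chains j p k, ∏ l : Fin k, barZeta (2 * i l.succ - 2 * i l.castSucc)

theorem mem_chains {j p k : ℕ} {i : Fin (k + 1) → ℕ} :
    i ∈ chains j p k ↔ StrictMono i ∧ i 0 = j ∧ i (Fin.last k) = p := by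
  classical
  simp only [chains, Finset.mem_filter, Fintype.mem_piFinset, Finset.mem_Icc, and_iff_right_iff_imp]
  rintro ⟨h, rfl, rfl⟩ a
  exact ⟨h.monotone (Fin.zero_le a), h.monotone (Fin.le_last a)⟩

theorem chains_eq_empty {j p k : ℕ} (h : p < j + k) : chains j p k = ∅ := by
  refine Finset.eq_empty_of_forall_notMem fun i hi => ?_
  obtain ⟨hi, h0, hk⟩ := mem_chains.1 hi
  have key : ∀ a : ℕ, ∀ ha : a < k + 1, j + a ≤ i ⟨a, ha⟩ := by
    intro a
    induction a with
    | zero => intro ha; exact (h0 ▸ le_rfl : j ≤ i 0)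
    | succ a ih =>
      intro ha
      have := ih (by omega)
      have h2 : i ⟨a, by omega⟩ < i ⟨a + 1, ha⟩ := hi (by simp [Fin.lt_def])
      omega
  have := key k (by omega)
  have h3 : i ⟨k, by omega⟩ = p := hk
  omega

theorem chainSum_eq_zero {j p k : ℕ} (h : p < j + k) : chainSum j p k = 0 := by
  rw [chainSum, chains_eq_empty h, Finset.sum_empty]

theorem chainSum_zero (j p : ℕ) : chainSum j p 0 = if j = p then 1 else 0 := by
  rw [chainSum]
  split_ifs with h
  · have : chains j p 0 = {fun _ => j} := by
      ext i
      rw [mem_chains, Finset.mem_singleton]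
      constructor
      · rintro ⟨-, h0, -⟩
        funext a
        rw [Fin.fin_one_eq_zero a, h0]
      · rintro rfl
        exact ⟨fun a b hab => absurd hab (by omega), rfl, h⟩
    simp [this]
  · have : chains j p 0 = ∅ := by
      refine Finset.eq_empty_of_forall_notMem fun i hi => ?_
      obtain ⟨-, h0, hk⟩ := mem_chains.1 hi
      exact h (h0.symm.trans hk)
    simp [this]

/-- A chain is cut at its second point: the first step gives the zeta factor, and the rest is a
chain starting there. -/
theorem chainSum_succ (j p k : ℕ) :
    chainSum j p (k + 1) = ∑ i ∈ Finset.Ioc j p, barZeta (2 * (i - j)) * chainSum i p k := by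
  simp only [chainSum, Finset.mul_sum]
  rw [Finset.sum_sigma']
  symm
  refine Finset.sum_bij' (fun a _ => (Fin.cons j a.2 : Fin (k + 2) → ℕ))
    (fun i _ => ⟨i 1, fun a => i a.succ⟩) ?_ ?_ ?_ ?_ ?_
  · rintro ⟨i, c⟩ h
    obtain ⟨hi, hc⟩ := Finset.mem_sigma.1 h
    obtain ⟨hc, h0, hk⟩ := mem_chains.1 hc
    replace h0 : c 0 = i := h0
    rw [Finset.mem_Ioc] at hi
    refine mem_chains.2 ⟨?_, rfl, ?_⟩
    · rw [Fin.strictMono_iff_lt_succ]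
      intro a
      refine Fin.cases ?_ (fun b => ?_) a
      · simpa [h0] using hi.1
      · have := hc (Fin.castSucc_lt_succ (i := b))
        rw [Fin.castSucc_succ, Fin.cons_succ, Fin.cons_succ]
        exact this
    · rw [← Fin.succ_last, Fin.cons_succ]
      exact hk
  · intro i hi
    obtain ⟨hi, h0, hk⟩ := mem_chains.1 hi
    refine Finset.mem_sigma.2 ⟨Finset.mem_Ioc.2 ⟨?_, ?_⟩, mem_chains.2 ⟨?_, rfl, ?_⟩⟩
    · rw [← h0]; exact hi (by simp)
    · rw [← hk]; exact hi.monotone (Fin.le_last _)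
    · exact hi.comp (Fin.strictMono_succ)
    · simpa using hk
  · rintro ⟨i, c⟩ h
    obtain ⟨-, hc⟩ := Finset.mem_sigma.1 h
    obtain ⟨-, h0, -⟩ := mem_chains.1 hc
    replace h0 : c 0 = i := h0
    subst h0
    rfl
  · intro i hi
    obtain ⟨-, h0, -⟩ := mem_chains.1 hi
    funext a
    refine Fin.cases ?_ (fun b => ?_) a
    · simp [h0]
    · simp
  · rintro ⟨i, c⟩ h
    obtain ⟨-, hc⟩ := Finset.mem_sigma.1 h
    obtain ⟨-, h0, -⟩ := mem_chains.1 hc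
    replace h0 : c 0 = i := h0
    rw [Fin.prod_univ_succ]
    congr 1
    · simp [h0, Nat.mul_sub]

/-- No chain from j to p has more than p - j steps, so one cut-off K serves all starting points at
once; the term k = 0 absorbs the convention Z(p, p) = 1. -/
theorem Z_eq_sum_chainSum {j p K : ℕ} (hj : j ≤ p) (hK : p - j ≤ K) :
    Z j p = ∑ k ∈ Finset.range (K + 1), (-2 : ℝ) ^ k * chainSum j p k := by
  rw [Finset.sum_range_succ', chainSum_zero, Z]
  split_ifs with h
  · rw [Finset.sum_eq_zero, zero_add, pow_zero, mul_one]
    intro k _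
    rw [chainSum_eq_zero (by omega), mul_zero]
  · rw [mul_zero, add_zero, Finset.sum_subset (Finset.Icc_subset_Icc_right hK), Finset.range_eq_Ico,
      Finset.sum_Ico_add' (fun k => (-2 : ℝ) ^ k * chainSum j p k) 0 K 1]
    · rfl
    · intro k _ hk
      have := chainSum_eq_zero (j := j) (p := p) (k := k) (by
        simp only [Finset.mem_Icc] at *; omega)
      rw [chainSum] at this
      rw [this, mul_zero]

theorem Z_eq_sum_Ioc {j p : ℕ} (hj : j < p) :
    Z j p = -2 * ∑ i ∈ Finset.Ioc j p, barZeta (2 * (i - j)) * Z i p := by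
  rw [Z_eq_sum_chainSum hj.le (Nat.le_succ _), Finset.sum_range_succ', chainSum_zero, if_neg hj.ne,
    mul_zero, add_zero]
  simp only [chainSum_succ, Finset.mul_sum]
  rw [Finset.sum_comm]
  refine Finset.sum_congr rfl fun i hi => ?_
  rw [Finset.mem_Ioc] at hi
  rw [Z_eq_sum_chainSum (K := p - j) hi.2 (by omega), Finset.mul_sum, Finset.mul_sum]
  refine Finset.sum_congr rfl fun k _ => ?_
  ring

/-! ### Even alternating zeta values and the series of sin(πx)/(πx) -/

/-- The Fourier series of the Bernoulli polynomial of degree 2n at x = 1/2, where cos(2πkx) =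
(-1)^k. -/
theorem barZeta_two_mul {n : ℕ} (hn : n ≠ 0) :
    barZeta (2 * n) = (-1) ^ n * (2 * Real.pi) ^ (2 * n) / 2 / (2 * n).factorial *
      (Polynomial.map (algebraMap ℚ ℝ) (Polynomial.bernoulli (2 * n))).eval (1 / 2) := by
  have h := (hasSum_one_div_nat_pow_mul_cos hn (x := 1 / 2) (by norm_num)).tendsto_sum_nat
  have h' := (h.comp (tendsto_add_atTop_nat 1)).neg
  refine tendsto_nhds_unique (tendsto_barZetaPartial (by omega : 2 * n ≠ 0)) ?_
  convert h' using 1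
  · funext N
    simp only [Function.comp, barZetaPartial, Finset.sum_range_succ']
    simp only [Nat.cast_zero, ne_eq, mul_eq_zero, OfNat.ofNat_ne_zero, hn, or_self,
      not_false_eq_true, zero_pow, div_zero, zero_mul, add_zero]
    rw [← Finset.sum_neg_distrib]
    refine Finset.sum_congr rfl fun k _ => ?_
    have : 2 * Real.pi * ((k + 1 : ℕ) : ℝ) * (1 / 2) = ((k + 1 : ℕ) : ℝ) * Real.pi := by ring
    rw [this, Real.cos_nat_mul_pi, pow_succ]
    push_cast
    ring
  · congr 1
    rw [pow_succ]
    ring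

/-- The coefficients of the power series `sin (π x) / (π x)` in `x ^ 2`. -/
def sincCoeff (n : ℕ) : ℝ :=
  (-1) ^ n * Real.pi ^ (2 * n) / (2 * n + 1).factorial

/-- The value at `1 / 2` of the `n`-th Bernoulli polynomial, divided by `n!`. -/
def halfBernoulli (n : ℕ) : ℝ :=
  Polynomial.aeval (1 / 2 : ℝ) ((1 / n.factorial : ℚ) • Polynomial.bernoulli n)

theorem halfBernoulli_eq (n : ℕ) : halfBernoulli n =
    (Polynomial.map (algebraMap ℚ ℝ) (Polynomial.bernoulli n)).eval (1 / 2) / n.factorial := by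
  rw [halfBernoulli, map_smul, Polynomial.aeval_def, Polynomial.eval_map, Rat.smul_def]
  push_cast
  ring

/-- Multiplying t ↦ X exp(tX) / (exp X - 1) at t = 1/2 through by exp(-X/2) makes the denominator
odd: the series is X / (2 sinh(X/2)). -/
theorem mk_halfBernoulli_mul :
    PowerSeries.mk halfBernoulli *
      (PowerSeries.rescale (1 / 2 : ℝ) (PowerSeries.exp ℝ) -
        PowerSeries.rescale (-1 / 2 : ℝ) (PowerSeries.exp ℝ)) = PowerSeries.X := by
  have h := Polynomial.bernoulli_generating_function (A := ℝ) (1 / 2)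
  have e1 := PowerSeries.exp_mul_exp_eq_exp_add (A := ℝ) 1 (-1 / 2)
  have e2 := PowerSeries.exp_mul_exp_eq_exp_add (A := ℝ) (1 / 2) (-1 / 2)
  norm_num at e1 e2
  have e1' : PowerSeries.exp ℝ * PowerSeries.rescale (-1 / 2 : ℝ) (PowerSeries.exp ℝ) =
      PowerSeries.rescale (1 / 2 : ℝ) (PowerSeries.exp ℝ) := by
    simpa [neg_div] using e1
  have e2' : PowerSeries.rescale (1 / 2 : ℝ) (PowerSeries.exp ℝ) *
      PowerSeries.rescale (-1 / 2 : ℝ) (PowerSeries.exp ℝ) = 1 := by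
    simpa [neg_div] using e2
  calc _ = (PowerSeries.mk halfBernoulli * (PowerSeries.exp ℝ - 1)) *
        PowerSeries.rescale (-1 / 2 : ℝ) (PowerSeries.exp ℝ) := by
        rw [mul_assoc, sub_mul, e1', one_mul]
    _ = PowerSeries.X := by
        have : PowerSeries.mk halfBernoulli * (PowerSeries.exp ℝ - 1) =
          PowerSeries.X * PowerSeries.rescale (1 / 2 : ℝ) (PowerSeries.exp ℝ) := h
        rw [this, mul_assoc, e2', mul_one]

theorem sum_antidiagonal_halfBernoulli {n : ℕ} (hn : n ≠ 0) :
    ∑ a ∈ Finset.HasAntidiagonal.antidiagonal n, halfBernoulli (2 * a.1) *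
      ((1 / 2) ^ (2 * a.2) / (2 * a.2 + 1).factorial) = 0 := by
  have h := congrArg (PowerSeries.coeff (2 * n + 1)) mk_halfBernoulli_mul
  rw [PowerSeries.coeff_X, if_neg (by omega), PowerSeries.coeff_mul] at h
  rw [← h]
  refine Finset.sum_of_injOn (fun a => (2 * a.1, 2 * a.2 + 1)) ?_ ?_ ?_ ?_
  · rintro ⟨a, b⟩ _ ⟨c, d⟩ _ h
    simp only [Prod.mk.injEq] at h ⊢
    omega
  · rintro ⟨a, b⟩ h
    simp at h ⊢
    omega
  · rintro ⟨a, b⟩ h h'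
    simp only [Finset.HasAntidiagonal.mem_antidiagonal] at h
    -- Pairs outside the image have b even, since an odd b forces a even; they contribute nothing
    -- because exp(X/2) - exp(-X/2) is odd.
    have hb : Even b := by
      by_contra hb
      rw [Nat.not_even_iff_odd] at hb
      obtain ⟨c, hc⟩ := hb
      exact h' ⟨(n - c, c), by simp; omega, by simp; omega⟩
    simp [PowerSeries.coeff_rescale, neg_div, hb.neg_pow]
  · rintro ⟨a, b⟩ h
    have hb : Odd (2 * b + 1) := ⟨b, rfl⟩
    simp only [PowerSeries.coeff_mk, map_sub, PowerSeries.coeff_rescale, neg_div, hb.neg_pow,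
      PowerSeries.coeff_exp]
    simp only [one_div, eq_ratCast, Rat.cast_inv, Rat.cast_natCast, pow_succ]
    ring

theorem halfBernoulli_zero : halfBernoulli 0 = 1 := by
  simp [halfBernoulli]

theorem two_mul_barZeta {n : ℕ} :
    2 * barZeta (2 * n) = (-1) ^ n * (2 * Real.pi) ^ (2 * n) * halfBernoulli (2 * n) := by
  rcases eq_or_ne n 0 with rfl | hn
  · simp [barZeta, halfBernoulli_zero]
  · rw [barZeta_two_mul hn, halfBernoulli_eq]
    ring

/-- The previous convolution after X ↦ 2πix: the product of πx/sin(πx) and sin(πx)/(πx) has no terms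
of positive degree. -/
theorem sum_antidiagonal_barZeta_mul_sincCoeff {n : ℕ} (hn : n ≠ 0) :
    ∑ a ∈ Finset.HasAntidiagonal.antidiagonal n, 2 * barZeta (2 * a.1) * sincCoeff a.2 = 0 := by
  have h := congrArg (fun t => (-1 : ℝ) ^ n * (2 * Real.pi) ^ (2 * n) * t)
    (sum_antidiagonal_halfBernoulli hn)
  simp only [mul_zero, Finset.mul_sum] at h
  rw [← h]
  refine Finset.sum_congr rfl fun a ha => ?_
  rw [Finset.HasAntidiagonal.mem_antidiagonal] at ha
  subst ha
  rw [two_mul_barZeta, sincCoeff]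
  have : (1 / 2 : ℝ) ^ (2 * a.2) * 2 ^ (2 * a.2) = 1 := by
    rw [← mul_pow]; norm_num
  simp only [mul_add, pow_add, mul_pow]
  linear_combination (-(-1) ^ a.1 * (2 ^ (2 * a.1) * Real.pi ^ (2 * a.1)) *
    halfBernoulli (2 * a.1) * (-1) ^ a.2 * Real.pi ^ (2 * a.2) / (2 * a.2 + 1).factorial) * this

theorem Z_eq_sincCoeff {j p : ℕ} (hj : j ≤ p) : Z j p = sincCoeff (p - j) := by
  obtain ⟨n, rfl⟩ := Nat.exists_eq_add_of_le hj
  clear hj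
  rw [Nat.add_sub_cancel_left]
  induction n using Nat.strong_induction_on generalizing j with
  | _ n ih =>
    rcases Nat.eq_zero_or_pos n with rfl | hn
    · simp [Z, sincCoeff]
    · rw [Z_eq_sum_Ioc (by omega)]
      have h := sum_antidiagonal_barZeta_mul_sincCoeff hn.ne'
      rw [Finset.Nat.sum_antidiagonal_eq_sum_range_succ_mk, Finset.sum_range_succ'] at h
      have h2 : ∑ i ∈ Finset.Ioc j (j + n), barZeta (2 * (i - j)) * Z i (j + n) =
          ∑ k ∈ Finset.range n, barZeta (2 * (k + 1)) * sincCoeff (n - (k + 1)) := by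
        rw [Finset.range_eq_Ico, Finset.sum_Ico_add'
          (fun k => barZeta (2 * k) * sincCoeff (n - k)) 0 n 1]
        refine Finset.sum_bij' (fun i _ => i - j) (fun k _ => k + j) ?_ ?_ ?_ ?_ ?_
        · intro i hi; simp at *; omega
        · intro i hi; simp at *; omega
        · intro i hi; simp at *; omega
        · intro i hi; simp
        · intro i hi
          simp only [Finset.mem_Ioc] at hi
          have := ih (n - (i - j)) (by omega) (j := i)
          rw [show i + (n - (i - j)) = j + n by omega] at this
          rw [this]
      rw [h2]
      simp only [mul_assoc, ← Finset.mul_sum] at h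
      -- The value `barZeta 0 = 1/2` makes the remaining term of the convolution exactly `sincCoeff
      -- n`.
      simp only [mul_zero, barZeta, if_true, Nat.sub_zero] at h ⊢
      linarith

/-! ### Truncated multiple sums, split at the last summation index -/

theorem mem_indices {k r : ℕ} {κ : Fin r → ℕ} :
    κ ∈ indices k r ↔ (∀ i, 1 ≤ κ i) ∧ ∑ i, κ i = k := by
  simp only [indices, Finset.mem_filter, Fintype.mem_piFinset, Finset.mem_Icc]
  refine ⟨fun h => ⟨fun i => (h.1 i).1, h.2⟩, fun h => ⟨fun i => ⟨h.1 i, ?_⟩, h.2⟩⟩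
  rw [← h.2]
  exact Finset.single_le_sum (f := κ) (fun _ _ => Nat.zero_le _) (Finset.mem_univ i)

theorem mem_increasingTuples {r N : ℕ} {n : Fin r → ℕ} :
    n ∈ increasingTuples r N ↔ (∀ i, 1 ≤ n i ∧ n i ≤ N) ∧ StrictMono n := by
  classical
  simp [increasingTuples]

theorem sum_increasingTuples_succ (r N : ℕ) (f : (Fin (r + 1) → ℕ) → ℝ) :
    ∑ n ∈ increasingTuples (r + 1) N, f n =
      ∑ m ∈ Finset.range N, ∑ n ∈ increasingTuples r m, f (Fin.snoc n (m + 1)) := by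
  rw [Finset.sum_sigma']
  symm
  refine Finset.sum_bij' (fun a _ => (Fin.snoc a.2 (a.1 + 1) : Fin (r + 1) → ℕ))
    (fun n _ => ⟨n (Fin.last r) - 1, Fin.init n⟩) ?_ ?_ ?_ ?_ ?_
  · rintro ⟨m, n⟩ h
    obtain ⟨hm, hn⟩ := Finset.mem_sigma.1 h
    rw [Finset.mem_range] at hm
    obtain ⟨hn, hn'⟩ := mem_increasingTuples.1 hn
    dsimp only at hm hn hn' ⊢
    refine mem_increasingTuples.2 ⟨fun i => ?_, fun i j hij => ?_⟩
    · refine Fin.lastCases ?_ (fun i => ?_) i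
      · simp only [Fin.snoc_last]; omega
      · simp only [Fin.snoc_castSucc]
        have := hn i
        omega
    · induction j using Fin.lastCases with
      | last =>
        induction i using Fin.lastCases with
        | last => exact absurd hij (lt_irrefl _)
        | cast i =>
          simp only [Fin.snoc_last, Fin.snoc_castSucc]
          have := (hn i).2
          omega
      | cast j =>
        induction i using Fin.lastCases with
        | last => exact absurd hij (not_lt.2 (Fin.le_last _))
        | cast i =>
          simp only [Fin.snoc_castSucc]
          exact hn' (by simpa using hij)
  · intro n hn
    obtain ⟨hn, hn'⟩ := mem_increasingTuples.1 hn
    have h1 := hn (Fin.last r)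
    refine Finset.mem_sigma.2 ⟨?_, mem_increasingTuples.2 ⟨fun i => ⟨(hn _).1, ?_⟩, ?_⟩⟩
    · simp only [Finset.mem_range]; omega
    · have : n i.castSucc < n (Fin.last r) := hn' (Fin.castSucc_lt_last i)
      simp only [Fin.init]
      omega
    · exact fun i j hij => hn' (by simpa using hij)
  · rintro ⟨m, n⟩ h
    simp
  · intro n hn
    obtain ⟨hn, -⟩ := mem_increasingTuples.1 hn
    have h1 := (hn (Fin.last r)).1
    simp only
    rw [Nat.sub_add_cancel h1]
    exact Fin.snoc_init_self n
  · rintro ⟨m, n⟩ h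
    rfl

/-- The truncated multiple sum `∑ 1 / ((2 n_1 - 1)^{k_1} ⋯ (2 n_r - r)^{k_r})` over
`0 < n_1 < ⋯ < n_r ≤ N`. -/
def tupleSum {r : ℕ} (κ : Fin r → ℕ) (N : ℕ) : ℝ :=
  ∑ n ∈ increasingTuples r N, ∏ i : Fin r, 1 / (2 * (n i : ℝ) - ((i : ℕ) + 1 : ℝ)) ^ κ i

/-- The part of `tupleSum κ` with last summation index `n + 1`. -/
def lastTerm {r : ℕ} (κ : Fin (r + 1) → ℕ) (n : ℕ) : ℝ :=
  tupleSum (Fin.init κ) n / (2 * (n : ℝ) + 1 - r) ^ κ (Fin.last r)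

theorem tupleSum_zero (κ : Fin 0 → ℕ) (N : ℕ) : tupleSum κ N = 1 := by
  have : increasingTuples 0 N = {Fin.elim0} := by
    ext n
    rw [mem_increasingTuples, Finset.mem_singleton]
    exact ⟨fun _ => funext fun i => i.elim0, fun _ => ⟨fun i => i.elim0, fun i => i.elim0⟩⟩
  simp [tupleSum, this]

theorem tupleSum_succ {r : ℕ} (κ : Fin (r + 1) → ℕ) (N : ℕ) :
    tupleSum κ N = ∑ n ∈ Finset.range N, lastTerm κ n := by
  rw [tupleSum, sum_increasingTuples_succ]
  refine Finset.sum_congr rfl fun m _ => ?_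
  rw [lastTerm, tupleSum, Finset.sum_div]
  refine Finset.sum_congr rfl fun n _ => ?_
  rw [Fin.prod_univ_castSucc, div_eq_mul_one_div]
  congr 1
  · simp [Fin.init]
  · simp only [Fin.snoc_last, Fin.val_last]
    push_cast
    ring

theorem barTPartial_succ {r : ℕ} (κ : Fin (r + 1) → ℕ) (N : ℕ) :
    barTPartial κ N = ∑ n ∈ Finset.range N, (-1) ^ n * (-2 ^ (r + 1) * lastTerm κ n) := by
  rw [barTPartial, sum_increasingTuples_succ, Finset.mul_sum]
  refine Finset.sum_congr rfl fun m _ => ?_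
  rw [lastTerm, tupleSum, Finset.sum_div, Finset.mul_sum, Finset.mul_sum, Finset.mul_sum]
  refine Finset.sum_congr rfl fun n _ => ?_
  rw [Fin.prod_univ_castSucc]
  have h1 : ∀ i : Fin r, ¬ ((i : ℕ) + 1 = r + 1) := fun i => by have := i.2; omega
  simp only [Fin.snoc_castSucc, Fin.snoc_last, Fin.val_last, Fin.val_castSucc, if_true, h1, if_false,
    Fin.init, pow_succ]
  push_cast
  rw [show 2 * ((m : ℝ) + 1) - (r + 1) = 2 * (m : ℝ) + 1 - r by ring]
  ring

/-- There is no strictly increasing r-tuple in [1, N]. This removes the terms n < r of `lastTerm`,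
where the denominator 2n + 1 - r need not be positive. -/
theorem tupleSum_eq_zero {r : ℕ} (κ : Fin r → ℕ) {N : ℕ} (h : N < r) : tupleSum κ N = 0 := by
  induction r generalizing N with
  | zero => omega
  | succ r ih =>
    rw [tupleSum_succ]
    refine Finset.sum_eq_zero fun n hn => ?_
    rw [Finset.mem_range] at hn
    rw [lastTerm, ih _ (by omega), zero_div]

theorem lastTerm_eq_zero {r : ℕ} (κ : Fin (r + 1) → ℕ) {n : ℕ} (h : n < r) : lastTerm κ n = 0 := by
  rw [lastTerm, tupleSum_eq_zero _ h, zero_div]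

/-! ### Convergence of the alternating series -/

/-- A logarithmic majorant. -/
def logBound (n : ℕ) : ℝ :=
  1 + ∑ i ∈ Finset.range n, 1 / ((i : ℝ) + 1)

theorem one_le_logBound (n : ℕ) : 1 ≤ logBound n := by
  rw [logBound, le_add_iff_nonneg_right]
  positivity

theorem logBound_mono : Monotone logBound := by
  intro a b h
  rw [logBound, logBound]
  gcongr

theorem le_two_mul_sub {r n : ℕ} (h : r ≤ n) : (n : ℝ) + 1 ≤ 2 * (n : ℝ) + 1 - r := by
  have : (r : ℝ) ≤ n := by exact_mod_cast h
  linarith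

theorem lastTerm_bounds_of_tupleSum_le {r : ℕ} (κ : Fin (r + 1) → ℕ) (hκ : ∀ i, 1 ≤ κ i) (n : ℕ)
    (h2 : 0 ≤ tupleSum (Fin.init κ) n) (h3 : tupleSum (Fin.init κ) n ≤ logBound n ^ r) :
    0 ≤ lastTerm κ n ∧ lastTerm κ n ≤ logBound n ^ r / ((n : ℝ) + 1) := by
  have hL : 0 ≤ logBound n := zero_le_one.trans (one_le_logBound n)
  rcases lt_or_ge n r with h | h
  · rw [lastTerm_eq_zero _ h]
    exact ⟨le_rfl, by positivity⟩
  · have h1 := le_two_mul_sub h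
    have hpos : (0 : ℝ) < (n : ℝ) + 1 := by positivity
    have h4 : (n : ℝ) + 1 ≤ (2 * (n : ℝ) + 1 - r) ^ κ (Fin.last r) :=
      h1.trans (le_self_pow₀ (by linarith) (by have := hκ (Fin.last r); omega))
    rw [lastTerm]
    refine ⟨div_nonneg h2 (by linarith), ?_⟩
    gcongr

theorem tupleSum_bounds {r : ℕ} (κ : Fin r → ℕ) (hκ : ∀ i, 1 ≤ κ i) (N : ℕ) :
    0 ≤ tupleSum κ N ∧ tupleSum κ N ≤ logBound N ^ r := by
  induction r generalizing N with
  | zero => simp [tupleSum_zero]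
  | succ r ih =>
    have key : ∀ n, 0 ≤ lastTerm κ n ∧ lastTerm κ n ≤ logBound n ^ r / ((n : ℝ) + 1) := fun n =>
      lastTerm_bounds_of_tupleSum_le κ hκ n (ih _ (fun i => hκ _) n).1 (ih _ (fun i => hκ _) n).2
    rw [tupleSum_succ]
    refine ⟨Finset.sum_nonneg fun n _ => (key n).1, ?_⟩
    calc ∑ n ∈ Finset.range N, lastTerm κ n
        ≤ ∑ n ∈ Finset.range N, logBound N ^ r * (1 / ((n : ℝ) + 1)) := by
          refine Finset.sum_le_sum fun n hn => (key n).2.trans ?_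
          have hL : 0 ≤ logBound n := zero_le_one.trans (one_le_logBound n)
          have := logBound_mono (Finset.mem_range.1 hn).le
          rw [div_eq_mul_one_div]
          gcongr
      _ ≤ logBound N ^ (r + 1) := by
          have hL : 0 ≤ logBound N := zero_le_one.trans (one_le_logBound N)
          rw [← Finset.mul_sum, pow_succ]
          gcongr
          rw [logBound]
          linarith

theorem lastTerm_bounds {r : ℕ} (κ : Fin (r + 1) → ℕ) (hκ : ∀ i, 1 ≤ κ i) (n : ℕ) :
    0 ≤ lastTerm κ n ∧ lastTerm κ n ≤ logBound n ^ r / ((n : ℝ) + 1) :=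
  lastTerm_bounds_of_tupleSum_le κ hκ n (tupleSum_bounds _ (fun _ => hκ _) n).1
    (tupleSum_bounds _ (fun _ => hκ _) n).2

theorem exists_logBound_pow_le (r : ℕ) :
    ∃ C : ℝ, 0 ≤ C ∧ ∀ n : ℕ, logBound n ^ r ≤ C * ((n : ℝ) + 1) ^ (1 / 2 : ℝ) := by
  -- With a = 2(r+1), L ≤ a exp(L/a) gives L^r ≤ a^r exp(rL/a), and rL/a ≤ L/2 ≤ 1 + log(n+1)/2.
  -- Using r + 1 keeps a nonzero at r = 0.
  refine ⟨(2 * (r + 1)) ^ r * Real.exp 1, by positivity, fun n => ?_⟩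
  have hL0 := one_le_logBound n
  have hL : logBound n ≤ 2 + Real.log ((n : ℝ) + 1) := by
    have h1 := harmonic_le_one_add_log n
    have h2 : ((harmonic n : ℚ) : ℝ) = ∑ i ∈ Finset.range n, 1 / ((i : ℝ) + 1) := by
      simp [harmonic]
    have h3 : Real.log n ≤ Real.log ((n : ℝ) + 1) := by
      rcases Nat.eq_zero_or_pos n with rfl | hn
      · simp
      · exact Real.log_le_log (by positivity) (by linarith)
    rw [logBound, ← h2]
    linarith
  have h1 : logBound n ≤ 2 * (r + 1) * Real.exp (logBound n / (2 * (r + 1))) := by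
    have := Real.add_one_le_exp (logBound n / (2 * (r + 1)))
    have h2 : logBound n = 2 * (r + 1) * (logBound n / (2 * (r + 1))) := by field_simp
    calc logBound n = 2 * (r + 1) * (logBound n / (2 * (r + 1))) := h2
      _ ≤ _ := by gcongr; linarith
  calc logBound n ^ r ≤ (2 * (r + 1) * Real.exp (logBound n / (2 * (r + 1)))) ^ r := by gcongr
    _ = (2 * (r + 1)) ^ r * Real.exp (r * (logBound n / (2 * (r + 1)))) := by
        rw [mul_pow, ← Real.exp_nat_mul]
    _ ≤ (2 * (r + 1)) ^ r * Real.exp (1 + Real.log ((n : ℝ) + 1) * (1 / 2)) := by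
        gcongr
        rw [← mul_div_assoc, div_le_iff₀ (by positivity)]
        have hr : (0 : ℝ) ≤ r := Nat.cast_nonneg r
        have hlog : 0 ≤ Real.log ((n : ℝ) + 1) := Real.log_nonneg (by linarith [(Nat.cast_nonneg n : (0:ℝ) ≤ n)])
        nlinarith [mul_le_mul_of_nonneg_left hL hr]
    _ = _ := by
        rw [Real.exp_add, Real.rpow_def_of_pos (by positivity), mul_assoc]

/-- Summation by parts: twice the alternating sum is an absolutely convergent sum of differences
plus two boundary terms. Monotonicity, which `lastTerm` need not have, is replaced by bounded
variation. -/
theorem exists_tendsto_alternating_sum {a : ℕ → ℝ} (h0 : Tendsto a atTop (𝓝 0))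
    (hs : Summable fun n => |a (n + 1) - a n|) :
    ∃ l, Tendsto (fun N => ∑ n ∈ Finset.range N, (-1) ^ n * a n) atTop (𝓝 l) := by
  have h1 : Summable fun n => (-1 : ℝ) ^ n * (a n - a (n + 1)) := by
    refine Summable.of_norm (hs.congr fun n => ?_)
    rw [norm_mul, norm_pow, norm_neg, norm_one, one_pow, one_mul, Real.norm_eq_abs, abs_sub_comm]
  have h2 := h1.hasSum.tendsto_sum_nat
  have h3 : Tendsto (fun N => (-1 : ℝ) ^ N * a N) atTop (𝓝 0) := by
    rw [tendsto_zero_iff_abs_tendsto_zero]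
    refine (tendsto_zero_iff_abs_tendsto_zero _).1 h0 |>.congr fun n => ?_
    simp [abs_mul, abs_pow]
  refine ⟨_, (((h2.sub h3).add_const (a 0)).div_const 2).congr fun N => ?_⟩
  have : ∀ N, ∑ n ∈ Finset.range N, (-1 : ℝ) ^ n * (a n - a (n + 1)) =
      2 * ∑ n ∈ Finset.range N, (-1 : ℝ) ^ n * a n - a 0 + (-1) ^ N * a N := by
    intro N
    induction N with
    | zero => simp
    | succ N ih => rw [Finset.sum_range_succ, Finset.sum_range_succ, ih, pow_succ]; ring
  rw [this]
  ring

theorem pow_sub_pow_le {s t : ℝ} (hs : 0 ≤ s) (hst : s ≤ t) (ht : t ≤ 1) (k : ℕ) :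
    t ^ k - s ^ k ≤ k * (t - s) := by
  induction k with
  | zero => simp
  | succ k ih =>
    have h1 : 0 ≤ t ^ k - s ^ k := sub_nonneg.2 (pow_le_pow_left₀ hs hst k)
    have h2 : s ^ k ≤ 1 := pow_le_one₀ hs (hst.trans ht)
    rw [pow_succ, pow_succ]
    push_cast
    nlinarith [mul_nonneg h1 (sub_nonneg.2 ht), mul_nonneg (sub_nonneg.2 h2) (sub_nonneg.2 hst)]

theorem tupleSum_succ_sub {r : ℕ} (κ : Fin r → ℕ) (hκ : ∀ i, 1 ≤ κ i) (n : ℕ) :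
    0 ≤ tupleSum κ (n + 1) - tupleSum κ n ∧
      tupleSum κ (n + 1) - tupleSum κ n ≤ logBound n ^ r / ((n : ℝ) + 1) := by
  have hL := one_le_logBound n
  rcases r with _ | r
  · rw [tupleSum_zero, tupleSum_zero, sub_self]
    exact ⟨le_rfl, by positivity⟩
  · rw [tupleSum_succ, tupleSum_succ, Finset.sum_range_succ, add_sub_cancel_left]
    refine ⟨(lastTerm_bounds κ hκ n).1, (lastTerm_bounds κ hκ n).2.trans ?_⟩
    gcongr
    omega

/-- The difference splits into the increment of the inner sum, of size log^r/n against a factor 1/n,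
and the inner sum times the increment of the last factor, of size 1/n². Summability of the variation
follows. -/
theorem abs_lastTerm_succ_sub {r : ℕ} (κ : Fin (r + 1) → ℕ) (hκ : ∀ i, 1 ≤ κ i) (n : ℕ) :
    |lastTerm κ (n + 1) - lastTerm κ n| ≤
      (1 + 2 * κ (Fin.last r)) * (logBound n ^ r / ((n : ℝ) + 1) ^ 2) := by
  set k := κ (Fin.last r)
  have hk : 1 ≤ k := hκ _
  have hL : 0 ≤ logBound n := zero_le_one.trans (one_le_logBound n)
  have hn : (0 : ℝ) < (n : ℝ) + 1 := by positivity
  obtain ⟨hd, hd'⟩ := tupleSum_succ_sub (Fin.init κ) (fun i => hκ _) n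
  obtain ⟨hS, hS'⟩ := tupleSum_bounds (Fin.init κ) (fun i => hκ _) n
  set d := tupleSum (Fin.init κ) (n + 1) - tupleSum (Fin.init κ) n
  set S := tupleSum (Fin.init κ) n
  set x : ℝ := 2 * (n : ℝ) + 1 - r
  have e : lastTerm κ (n + 1) - lastTerm κ n =
      d * (1 / (x + 2)) ^ k - S * ((1 / x) ^ k - (1 / (x + 2)) ^ k) := by
    simp only [lastTerm, d, S, x, k]
    push_cast
    rw [show 2 * ((n : ℝ) + 1) + 1 - r = 2 * (n : ℝ) + 1 - r + 2 by ring, one_div_pow, one_div_pow]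
    ring
  have h1 : 0 ≤ d * (1 / (x + 2)) ^ k ∧ d * (1 / (x + 2)) ^ k ≤
      logBound n ^ r / ((n : ℝ) + 1) ^ 2 := by
    -- The denominator here belongs to the index n + 1, so the degenerate range ends one place
    -- earlier than for the second summand.
    rcases lt_or_ge (n + 1) r with h | h
    · have : d = 0 := by
        simp only [d]
        rw [tupleSum_eq_zero _ h, tupleSum_eq_zero _ (by omega), sub_zero]
      rw [this, zero_mul]
      exact ⟨le_rfl, by positivity⟩
    · have h2 := le_two_mul_sub h
      have h3 : (n : ℝ) + 1 ≤ x + 2 := by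
        simp only [x]; push_cast at h2; linarith
      refine ⟨mul_nonneg hd (pow_nonneg (one_div_nonneg.2 (by linarith)) _), ?_⟩
      calc d * (1 / (x + 2)) ^ k ≤ (logBound n ^ r / ((n : ℝ) + 1)) * (1 / ((n : ℝ) + 1)) := by
            have hx : (0 : ℝ) < x + 2 := by linarith
            gcongr
            refine (pow_le_of_le_one (one_div_nonneg.2 hx.le) ?_ (Nat.one_le_iff_ne_zero.1 hk)).trans ?_
            · rw [div_le_one hx]
              have : (0 : ℝ) ≤ n := Nat.cast_nonneg n
              linarith
            · gcongr
        _ = _ := by rw [pow_two]; field_simp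
  have h2 : 0 ≤ S * ((1 / x) ^ k - (1 / (x + 2)) ^ k) ∧
      S * ((1 / x) ^ k - (1 / (x + 2)) ^ k) ≤ 2 * k * (logBound n ^ r / ((n : ℝ) + 1) ^ 2) := by
    rcases lt_or_ge n r with h | h
    · have : S = 0 := tupleSum_eq_zero _ h
      rw [this, zero_mul]
      exact ⟨le_rfl, by positivity⟩
    · have h3 : (n : ℝ) + 1 ≤ x := le_two_mul_sub h
      have hx1 : 1 ≤ x := le_trans (by linarith [(Nat.cast_nonneg n : (0:ℝ) ≤ n)]) h3
      have hx : 0 < x := by linarith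
      have h4 : 1 / (x + 2) ≤ 1 / x := by gcongr; linarith
      have h5 : 0 ≤ 1 / (x + 2) := by positivity
      refine ⟨mul_nonneg hS (sub_nonneg.2 (pow_le_pow_left₀ h5 h4 _)), ?_⟩
      have h6 : (1 / x) ^ k - (1 / (x + 2)) ^ k ≤ 2 * k * (1 / ((n : ℝ) + 1) ^ 2) := by
        refine (pow_sub_pow_le h5 h4 ((div_le_one hx).2 hx1) k).trans ?_
        have : 1 / x - 1 / (x + 2) ≤ 2 * (1 / ((n : ℝ) + 1) ^ 2) := by
          calc 1 / x - 1 / (x + 2) = 2 * (1 / (x * (x + 2))) := by field_simp; ring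
            _ ≤ 2 * (1 / ((n : ℝ) + 1) ^ 2) := by
                rw [pow_two]
                refine mul_le_mul_of_nonneg_left (one_div_le_one_div_of_le (by positivity)
                  (mul_le_mul h3 (by linarith) hn.le hx.le)) (by norm_num)
        calc (k : ℝ) * (1 / x - 1 / (x + 2)) ≤ k * (2 * (1 / ((n : ℝ) + 1) ^ 2)) := by gcongr
          _ = _ := by ring
      calc S * ((1 / x) ^ k - (1 / (x + 2)) ^ k)
          ≤ logBound n ^ r * (2 * k * (1 / ((n : ℝ) + 1) ^ 2)) := by
            refine mul_le_mul hS' h6 (sub_nonneg.2 (pow_le_pow_left₀ h5 h4 _)) (by positivity)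
        _ = _ := by ring
  rw [e, abs_le]
  constructor <;> linarith [h1.1, h1.2, h2.1, h2.2, mul_nonneg (by positivity : (0 : ℝ) ≤ 2 * k)
    (by positivity : 0 ≤ logBound n ^ r / ((n : ℝ) + 1) ^ 2)]

theorem tendsto_lastTerm {r : ℕ} (κ : Fin (r + 1) → ℕ) (hκ : ∀ i, 1 ≤ κ i) :
    Tendsto (lastTerm κ) atTop (𝓝 0) := by
  obtain ⟨C, hC, h⟩ := exists_logBound_pow_le r
  refine squeeze_zero (fun n => (lastTerm_bounds κ hκ n).1)
    (g := fun n : ℕ => C * ((n : ℝ) + 1) ^ (-(1 / 2) : ℝ)) (fun n => ?_) ?_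
  · refine (lastTerm_bounds κ hκ n).2.trans ?_
    have hn : (0 : ℝ) < (n : ℝ) + 1 := by positivity
    rw [div_le_iff₀ hn, mul_assoc, ← Real.rpow_add_one hn.ne']
    norm_num
    simpa using h n
  · have := (tendsto_rpow_neg_atTop (by norm_num : (0 : ℝ) < 1 / 2)).comp
      (tendsto_atTop_add_const_right atTop 1 tendsto_natCast_atTop_atTop)
    simpa using this.const_mul C

theorem exists_tendsto_alternating_lastTerm {r : ℕ} (κ : Fin (r + 1) → ℕ) (hκ : ∀ i, 1 ≤ κ i) :
    ∃ l, Tendsto (fun N => ∑ n ∈ Finset.range N, (-1) ^ n * lastTerm κ n) atTop (𝓝 l) := by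
  refine exists_tendsto_alternating_sum (tendsto_lastTerm κ hκ) ?_
  obtain ⟨C, hC, h⟩ := exists_logBound_pow_le r
  have hs : Summable fun n : ℕ => ((n : ℝ) + 1) ^ (-(3 / 2) : ℝ) := by
    have := (summable_nat_add_iff 1).2 (Real.summable_nat_rpow.2 (by norm_num : (-(3 / 2) : ℝ) < -1))
    simpa using this
  refine Summable.of_nonneg_of_le (fun n => abs_nonneg _)
    (fun n => (abs_lastTerm_succ_sub κ hκ n).trans ?_) (hs.mul_left ((1 + 2 * κ (Fin.last r)) * C))
  rw [mul_assoc]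
  gcongr
  have hn : (0 : ℝ) < (n : ℝ) + 1 := by positivity
  rw [div_le_iff₀ (by positivity), mul_assoc, ← Real.rpow_natCast (_ + 1), ← Real.rpow_add hn]
  norm_num
  simpa using h n

theorem tendsto_barTPartial {r : ℕ} (κ : Fin (r + 1) → ℕ) (hκ : ∀ i, 1 ≤ κ i) :
    Tendsto (barTPartial κ) atTop (𝓝 (barT κ)) := by
  obtain ⟨l, hl⟩ := exists_tendsto_alternating_lastTerm κ hκ
  have h : Tendsto (barTPartial κ) atTop (𝓝 (-2 ^ (r + 1) * l)) := by
    refine (hl.const_mul (-2 ^ (r + 1))).congr fun N => ?_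
    rw [barTPartial_succ, Finset.mul_sum]
    exact Finset.sum_congr rfl fun n _ => by ring
  rw [barT, h.limUnder_eq]
  exact h

/-! ### Sums over all indices of given weight and depth -/

/-- The sum of the truncated multiple sums of weight `k` and depth `r`. -/
def weightSum (k r N : ℕ) : ℝ :=
  ∑ κ ∈ indices k r, tupleSum κ N

/-- The part of `weightSum k (r + 1)` with last summation index `n + 1`. -/
def weightTerm (k r n : ℕ) : ℝ :=
  ∑ κ ∈ indices k (r + 1), lastTerm κ n

theorem indices_eq_empty {k r : ℕ} (h : k < r) : indices k r = ∅ := by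
  refine Finset.eq_empty_of_forall_notMem fun κ hκ => ?_
  obtain ⟨h1, h2⟩ := mem_indices.1 hκ
  have : ∑ _i : Fin r, 1 ≤ ∑ i, κ i := Finset.sum_le_sum fun i _ => h1 i
  simp at this
  omega

theorem weightSum_zero (k N : ℕ) : weightSum k 0 N = if k = 0 then 1 else 0 := by
  rw [weightSum]
  split_ifs with h
  · have : indices k 0 = {Fin.elim0} := by
      ext κ
      rw [mem_indices, Finset.mem_singleton]
      exact ⟨fun _ => funext fun i => i.elim0, fun _ => ⟨fun i => i.elim0, by simp [h]⟩⟩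
    rw [this, Finset.sum_singleton, tupleSum_zero]
  · refine Finset.sum_eq_zero fun κ hκ => absurd ?_ h
    simpa using (mem_indices.1 hκ).2.symm

theorem weightSum_succ (k r N : ℕ) :
    weightSum k (r + 1) N = ∑ n ∈ Finset.range N, weightTerm k r n := by
  simp only [weightSum, weightTerm, tupleSum_succ]
  exact Finset.sum_comm

theorem weightSum_eq_zero {k r n : ℕ} (h : n < r) : weightSum k r n = 0 :=
  Finset.sum_eq_zero fun κ _ => tupleSum_eq_zero κ h

theorem weightTerm_eq_zero {k r n : ℕ} (h : n < r) : weightTerm k r n = 0 :=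
  Finset.sum_eq_zero fun κ _ => lastTerm_eq_zero κ h

theorem weightTerm_of_le {k r : ℕ} (h : k ≤ r) (n : ℕ) : weightTerm k r n = 0 := by
  rw [weightTerm, indices_eq_empty (by omega), Finset.sum_empty]

/-- The indices of depth `r + 1` are split according to whether the last entry is `1`. -/
theorem sum_indices_succ (k r : ℕ) (f : (Fin r → ℕ) → ℕ → ℝ) :
    ∑ κ ∈ indices (k + 1) (r + 1), f (Fin.init κ) (κ (Fin.last r)) =
      ∑ κ ∈ indices k r, f κ 1 +
        ∑ κ ∈ indices k (r + 1), f (Fin.init κ) (κ (Fin.last r) + 1) := by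
  rw [← Finset.sum_filter_add_sum_filter_not _ fun κ : Fin (r + 1) → ℕ => κ (Fin.last r) = 1]
  congr 1
  · refine Finset.sum_bij' (fun κ _ => Fin.init κ) (fun κ _ => (Fin.snoc κ 1 : Fin (r + 1) → ℕ))
      ?_ ?_ ?_ ?_ ?_
    · intro κ hκ
      obtain ⟨hκ, h1⟩ := Finset.mem_filter.1 hκ
      obtain ⟨h2, h3⟩ := mem_indices.1 hκ
      rw [Fin.sum_univ_castSucc, h1] at h3
      exact mem_indices.2 ⟨fun i => h2 _, by simpa [Fin.init] using h3⟩
    · intro κ hκ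
      obtain ⟨h2, h3⟩ := mem_indices.1 hκ
      refine Finset.mem_filter.2 ⟨mem_indices.2 ⟨fun i => ?_, ?_⟩, by simp⟩
      · refine Fin.lastCases ?_ (fun i => ?_) i
        · simp
        · simpa using h2 i
      · simp [Fin.sum_univ_castSucc, h3]
    · intro κ hκ
      obtain ⟨-, h1⟩ := Finset.mem_filter.1 hκ
      funext i
      refine Fin.lastCases ?_ (fun i => ?_) i
      · simp [h1]
      · simp [Fin.init]
    · intro κ hκ
      simp
    · intro κ hκ
      rw [(Finset.mem_filter.1 hκ).2]
  · refine Finset.sum_bij'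
      (fun κ _ => (Fin.snoc (Fin.init κ) (κ (Fin.last r) - 1) : Fin (r + 1) → ℕ))
      (fun κ _ => (Fin.snoc (Fin.init κ) (κ (Fin.last r) + 1) : Fin (r + 1) → ℕ)) ?_ ?_ ?_ ?_ ?_
    · intro κ hκ
      obtain ⟨hκ, h1⟩ := Finset.mem_filter.1 hκ
      obtain ⟨h2, h3⟩ := mem_indices.1 hκ
      have h4 := h2 (Fin.last r)
      refine mem_indices.2 ⟨fun i => ?_, ?_⟩
      · refine Fin.lastCases ?_ (fun i => ?_) i
        · simp only [Fin.snoc_last]; omega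
        · simpa [Fin.init] using h2 i.castSucc
      · rw [Fin.sum_univ_castSucc] at h3 ⊢
        simp only [Fin.snoc_castSucc, Fin.snoc_last, Fin.init]
        omega
    · intro κ hκ
      obtain ⟨h2, h3⟩ := mem_indices.1 hκ
      have h4 := h2 (Fin.last r)
      refine Finset.mem_filter.2 ⟨mem_indices.2 ⟨fun i => ?_, ?_⟩, ?_⟩
      · refine Fin.lastCases ?_ (fun i => ?_) i
        · simp
        · simpa [Fin.init] using h2 i.castSucc
      · rw [Fin.sum_univ_castSucc] at h3 ⊢
        simp only [Fin.snoc_castSucc, Fin.snoc_last, Fin.init]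
        omega
      · simp only [Fin.snoc_last]; omega
    · intro κ hκ
      have h4 := (mem_indices.1 (Finset.mem_filter.1 hκ).1).1 (Fin.last r)
      simp [Nat.sub_add_cancel h4]
    · intro κ hκ
      simp
    · intro κ hκ
      have h4 := (mem_indices.1 (Finset.mem_filter.1 hκ).1).1 (Fin.last r)
      simp [Nat.sub_add_cancel h4]

/-- Multiplication by the last denominator lowers the last exponent by one: a last entry 1
disappears and leaves depth r, a larger one leaves an index of the same depth. -/
theorem mul_weightTerm_succ (k r n : ℕ) :
    (2 * (n : ℝ) + 1 - r) * weightTerm (k + 1) r n = weightSum k r n + weightTerm k r n := by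
  rcases lt_or_ge n r with h | h
  · rw [weightTerm_eq_zero h, weightTerm_eq_zero h, weightSum_eq_zero h]
    ring
  · have h1 := le_two_mul_sub h
    have hx : (2 * (n : ℝ) + 1 - r) ≠ 0 := by
      have : (0 : ℝ) ≤ n := Nat.cast_nonneg n
      linarith
    have := sum_indices_succ k r fun κ l => tupleSum κ n / (2 * (n : ℝ) + 1 - r) ^ l
    simp only [weightTerm, lastTerm, weightSum]
    rw [this, mul_add, Finset.mul_sum, Finset.mul_sum]
    congr 1
    · refine Finset.sum_congr rfl fun κ _ => ?_
      field_simp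
    · refine Finset.sum_congr rfl fun κ _ => ?_
      rw [pow_succ]
      field_simp

theorem tendsto_W (k r : ℕ) :
    Tendsto (fun N => ∑ n ∈ Finset.range N, (-1) ^ n * (-2 ^ (r + 1) * weightTerm k r n)) atTop
      (𝓝 (W k (r + 1))) := by
  have : Tendsto (fun N => ∑ κ ∈ indices k (r + 1), barTPartial κ N) atTop (𝓝 (W k (r + 1))) :=
    tendsto_finsetSum _ fun κ hκ => tendsto_barTPartial κ (mem_indices.1 hκ).1
  refine this.congr fun N => ?_
  simp only [barTPartial_succ, weightTerm, Finset.mul_sum]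
  exact Finset.sum_comm

theorem exists_abs_weightTerm_le (k r : ℕ) : ∃ C : ℝ, 0 ≤ C ∧ ∀ n, |weightTerm k r n| ≤ C := by
  have : Tendsto (weightTerm k r) atTop (𝓝 (∑ κ ∈ indices k (r + 1), 0)) :=
    tendsto_finsetSum _ fun κ hκ => tendsto_lastTerm κ (mem_indices.1 hκ).1
  obtain ⟨C, hC⟩ := (Metric.isBounded_range_of_tendsto _ this).exists_norm_le
  exact ⟨C, (norm_nonneg _).trans (hC _ ⟨0, rfl⟩), fun n => hC _ ⟨n, rfl⟩⟩

/-! ### Exponential generating series and their differential equations -/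

/-- The generating series of the terms of `W k r`, in the variable `exp (-u)`. -/
def expSeries : ℕ → ℕ → ℝ → ℝ
  | k, 0, _ => if k = 0 then 1 else 0
  | k, r + 1, u => ∑' n : ℕ, (-1) ^ n * (-2 ^ (r + 1) * weightTerm k r n) *
      Real.exp (-u * (2 * (n : ℝ) + 1 - r))

theorem exp_neg_mul_le {u : ℝ} (hu : 0 ≤ u) {r n : ℕ} (h : r ≤ n) :
    Real.exp (-u * (2 * (n : ℝ) + 1 - r)) ≤ Real.exp (-u) * Real.exp (-u) ^ n := by
  rw [← Real.exp_nat_mul, ← Real.exp_add, Real.exp_le_exp]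
  nlinarith [le_two_mul_sub h]

theorem exists_abs_expSeries_term_le (k r : ℕ) : ∃ C : ℝ, 0 ≤ C ∧ ∀ u : ℝ, 0 ≤ u → ∀ n : ℕ,
    |(-1) ^ n * (-2 ^ (r + 1) * weightTerm k r n) * Real.exp (-u * (2 * (n : ℝ) + 1 - r))| ≤
      C * (Real.exp (-u) * Real.exp (-u) ^ n) := by
  obtain ⟨C, hC, h⟩ := exists_abs_weightTerm_le k r
  refine ⟨2 ^ (r + 1) * C, by positivity, fun u hu n => ?_⟩
  rcases lt_or_ge n r with hn | hn
  · rw [weightTerm_eq_zero hn]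
    simp
    positivity
  · simp only [abs_mul, abs_pow, abs_neg, abs_one, one_pow, one_mul, Nat.abs_ofNat, Real.abs_exp]
    gcongr
    · exact h n
    · exact exp_neg_mul_le hu hn

theorem summable_exp_neg_pow {u : ℝ} (hu : 0 < u) :
    Summable fun n : ℕ => Real.exp (-u) * Real.exp (-u) ^ n :=
  (summable_geometric_of_lt_one (Real.exp_pos _).le (by simpa using hu)).mul_left _

theorem summable_expSeries (k r : ℕ) {u : ℝ} (hu : 0 < u) :
    Summable fun n : ℕ => (-1) ^ n * (-2 ^ (r + 1) * weightTerm k r n) *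
      Real.exp (-u * (2 * (n : ℝ) + 1 - r)) := by
  obtain ⟨C, -, h⟩ := exists_abs_expSeries_term_le k r
  exact Summable.of_norm_bounded ((summable_exp_neg_pow hu).mul_left C) (h u hu.le)

theorem exists_abs_expSeries_le (k r : ℕ) : ∃ C : ℝ, 0 ≤ C ∧ ∀ u : ℝ, 1 ≤ u →
    |expSeries k (r + 1) u| ≤ C * Real.exp (-u) := by
  obtain ⟨C, hC, h⟩ := exists_abs_expSeries_term_le k r
  refine ⟨C * (1 - Real.exp (-1))⁻¹, ?_, fun u hu => ?_⟩
  · have : Real.exp (-1) ≤ 1 := by simp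
    exact mul_nonneg hC (inv_nonneg.2 (by linarith))
  · have hu0 : 0 < u := by linarith
    have h1 : Real.exp (-1) < 1 := by simp
    have h2 : Real.exp (-u) ≤ Real.exp (-1) := by simpa using hu
    have h3 := (hasSum_geometric_of_lt_one (Real.exp_pos (-u)).le (h2.trans_lt h1)).mul_left
      (C * Real.exp (-u))
    rw [expSeries, ← Real.norm_eq_abs]
    refine (tsum_of_norm_bounded h3 fun n => ?_).trans ?_
    · rw [Real.norm_eq_abs, mul_assoc C]
      exact h u hu0.le n
    · have : (1 - Real.exp (-u))⁻¹ ≤ (1 - Real.exp (-1))⁻¹ := by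
        gcongr
      calc _ ≤ C * Real.exp (-u) * (1 - Real.exp (-1))⁻¹ := by gcongr
        _ = _ := by ring

/-- Abel's limit theorem in the variable exp(-2u); the leftover factor exp(-u(1-r)) tends to 1. -/
theorem tendsto_expSeries_nhdsWithin_zero (k r : ℕ) :
    Tendsto (expSeries k (r + 1)) (𝓝[>] 0) (𝓝 (W k (r + 1))) := by
  have h := Real.tendsto_tsum_powerSeries_nhdsWithin_lt (tendsto_W k r)
  have h2 : Tendsto (fun u : ℝ => Real.exp (-(2 * u))) (𝓝[>] 0) (𝓝[<] 1) := by
    refine tendsto_nhdsWithin_iff.2 ⟨?_, ?_⟩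
    · have : Continuous fun u : ℝ => Real.exp (-(2 * u)) := by fun_prop
      exact (this.tendsto' 0 1 (by simp)).mono_left nhdsWithin_le_nhds
    · filter_upwards [self_mem_nhdsWithin] with u hu
      simpa using hu
  have h3 : Tendsto (fun u : ℝ => Real.exp (-u * (1 - r))) (𝓝[>] 0) (𝓝 1) := by
    have : Continuous fun u : ℝ => Real.exp (-u * (1 - r)) := by fun_prop
    exact (this.tendsto' 0 1 (by simp)).mono_left nhdsWithin_le_nhds
  have h4 := (h.comp h2).mul h3
  rw [mul_one] at h4
  refine h4.congr fun u => ?_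
  rw [Function.comp, expSeries, ← tsum_mul_right]
  refine tsum_congr fun n => ?_
  rw [mul_assoc, ← Real.exp_nat_mul, ← Real.exp_add]
  congr 2
  ring

/-- Summation by parts: multiplying by 1 + exp(-2u) turns partial sums back into terms, and 2
exp(-u)/(1 + exp(-2u)) = 1/cosh u. Depth 0 is a geometric series. -/
theorem hasSum_weightSum (k r : ℕ) {u : ℝ} (hu : 0 < u) :
    HasSum (fun n : ℕ => (-1) ^ n * (2 ^ (r + 1) * weightSum k r n) *
      Real.exp (-u * (2 * (n : ℝ) + 1 - r))) (expSeries k r u / Real.cosh u) := by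
  have hexp : Real.exp (-u) < 1 := by simpa using hu
  have hsq : Real.exp (-2 * u) = Real.exp (-u) * Real.exp (-u) := by
    rw [← Real.exp_add]; congr 1; ring
  have hcosh : Real.cosh u = (1 + Real.exp (-2 * u)) / (2 * Real.exp (-u)) := by
    have : Real.exp u * Real.exp (-u) = 1 := by rw [← Real.exp_add]; simp
    rw [Real.cosh_eq, hsq]
    field_simp
    linear_combination this
  have hpos : 0 < 1 + Real.exp (-2 * u) := by positivity
  rcases r with _ | r
  · have hq : ‖-Real.exp (-2 * u)‖ < 1 := by
      rw [norm_neg, Real.norm_eq_abs, Real.abs_exp]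
      simpa using hu
    have h := (hasSum_geometric_of_norm_lt_one hq).mul_left
      (2 * Real.exp (-u) * if k = 0 then 1 else 0)
    have e : expSeries k 0 u / Real.cosh u =
        (2 * Real.exp (-u) * if k = 0 then 1 else 0) * (1 - -Real.exp (-2 * u))⁻¹ := by
      simp only [expSeries]
      rw [hcosh, sub_neg_eq_add]
      field_simp
    rw [e]
    refine h.congr_fun fun n => ?_
    rw [weightSum_zero, neg_pow (Real.exp _), ← Real.exp_nat_mul]
    have : Real.exp (-u * (2 * (n : ℝ) + 1 - (0 : ℕ))) =
        Real.exp (-u) * Real.exp (n * (-2 * u)) := by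
      rw [← Real.exp_add]; congr 1; push_cast; ring
    rw [this]
    ring
  · set f : ℕ → ℝ := fun n : ℕ => (-1) ^ n * (2 ^ (r + 1 + 1) * weightSum k (r + 1) n) *
      Real.exp (-u * (2 * (n : ℝ) + 1 - (r + 1 : ℕ))) with hf
    have hs : Summable f := by
      obtain ⟨C, hC, h⟩ := exists_abs_weightTerm_le k r
      have h1 : Summable fun n : ℕ => (n : ℝ) ^ 1 * Real.exp (-u) ^ n :=
        summable_pow_mul_geometric_of_norm_lt_one 1 (by simpa using hu)
      refine Summable.of_norm_bounded (h1.mul_left (2 ^ (r + 1 + 1) * C * Real.exp (-u)))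
        fun n => ?_
      have h2 : |weightSum k (r + 1) n| ≤ n * C := by
        rw [weightSum_succ]
        refine (Finset.abs_sum_le_sum_abs _ _).trans ((Finset.sum_le_sum fun i _ => h i).trans ?_)
        simp
      simp only [hf]
      rcases lt_or_ge n (r + 1) with hn | hn
      · rw [weightSum_eq_zero hn]
        simp
        positivity
      · simp only [norm_mul, norm_pow, norm_neg, norm_one, one_pow, one_mul, Real.norm_eq_abs,
          Nat.abs_ofNat, Real.abs_exp]
        calc _ ≤ 2 ^ (r + 1 + 1) * (n * C) * (Real.exp (-u) * Real.exp (-u) ^ n) := by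
              gcongr
              exact exp_neg_mul_le hu.le hn
          _ = _ := by ring
    -- Since f vanishes at 0, reindexing by n + 1 does not change the sum, and the recursion for f
    -- becomes a linear equation for its sum.
    have h0 : f 0 = 0 := by simp [hf, weightSum_succ]
    have e : ∀ n, f (n + 1) = -Real.exp (-2 * u) * f n + 2 * Real.exp (-u) *
        ((-1) ^ n * (-2 ^ (r + 1) * weightTerm k r n) *
          Real.exp (-u * (2 * (n : ℝ) + 1 - r))) := by
      intro n
      have e1 : Real.exp (-u * (2 * ((n + 1 : ℕ) : ℝ) + 1 - (r + 1 : ℕ))) =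
          Real.exp (-u) * Real.exp (-u * (2 * (n : ℝ) + 1 - r)) := by
        rw [← Real.exp_add]; congr 1; push_cast; ring
      have e2 : Real.exp (-2 * u) * Real.exp (-u * (2 * (n : ℝ) + 1 - (r + 1 : ℕ))) =
          Real.exp (-u) * Real.exp (-u * (2 * (n : ℝ) + 1 - r)) := by
        rw [← Real.exp_add, ← Real.exp_add]; congr 1; push_cast; ring
      simp only [hf]
      rw [e1, weightSum_succ, Finset.sum_range_succ, ← weightSum_succ]
      linear_combination ((-1) ^ n * (2 ^ (r + 1 + 1) * weightSum k (r + 1) n)) * e2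
    have h2 := hs.tsum_eq_zero_add
    rw [h0, zero_add, tsum_congr e, Summable.tsum_add (hs.mul_left _)
      ((summable_expSeries k r hu).mul_left _), tsum_mul_left, tsum_mul_left] at h2
    have h3 : expSeries k (r + 1) u / Real.cosh u = ∑' n, f n := by
      change _ = _ + 2 * Real.exp (-u) * expSeries k (r + 1) u at h2
      rw [hcosh, div_div_eq_mul_div, div_eq_iff hpos.ne']
      linear_combination (-1 : ℝ) * h2
    rw [h3]
    exact hs.hasSum

/-- Differentiation brings down the factor -(2n + 1 - r), to which `mul_weightTerm_succ` applies;
the resulting partial sums are resummed by `hasSum_weightSum`. -/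
theorem hasDerivAt_expSeries (k r : ℕ) {u : ℝ} (hu : 0 < u) :
    HasDerivAt (expSeries (k + 1) (r + 1))
      (-expSeries k (r + 1) u + expSeries k r u / Real.cosh u) u := by
  obtain ⟨C, hC, h⟩ := exists_abs_weightTerm_le (k + 1) r
  have hsum : Summable fun n : ℕ =>
      2 ^ (r + 1) * C * (2 * (n : ℝ) + 1) * (Real.exp (-(u / 2)) * Real.exp (-(u / 2)) ^ n) := by
    have h1 : Summable fun n : ℕ => (n : ℝ) ^ 1 * Real.exp (-(u / 2)) ^ n :=
      summable_pow_mul_geometric_of_norm_lt_one 1 (by simpa using hu)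
    refine ((h1.mul_left (2 ^ (r + 1) * C * 2 * Real.exp (-(u / 2)))).add
      ((summable_exp_neg_pow (half_pos hu)).mul_left (2 ^ (r + 1) * C))).congr fun n => ?_
    ring
  -- On (u/2, ∞) the differentiated terms have one summable majorant, which is not available on all
  -- of (0, ∞).
  have hd := hasDerivAt_tsum_of_isPreconnected (t := Set.Ioi (u / 2)) (y₀ := u) (y := u) hsum
    isOpen_Ioi isPreconnected_Ioi
    (g := fun n v => (-1) ^ n * (-2 ^ (r + 1) * weightTerm (k + 1) r n) *
      Real.exp (-v * (2 * (n : ℝ) + 1 - r)))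
    (g' := fun n v => (-1) ^ n * (-2 ^ (r + 1) * weightTerm (k + 1) r n) *
      (Real.exp (-v * (2 * (n : ℝ) + 1 - r)) * (-1 * (2 * (n : ℝ) + 1 - r))))
    (fun n v _ => (((hasDerivAt_id v).neg.mul_const _).exp.const_mul _)) ?_
    (half_lt_self hu) (summable_expSeries (k + 1) r hu) (half_lt_self hu)
  · have e : ∑' n : ℕ, (-1 : ℝ) ^ n * (-2 ^ (r + 1) * weightTerm (k + 1) r n) *
        (Real.exp (-u * (2 * (n : ℝ) + 1 - r)) * (-1 * (2 * (n : ℝ) + 1 - r))) =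
        -expSeries k (r + 1) u + expSeries k r u / Real.cosh u := by
      refine HasSum.tsum_eq ?_
      have h1 := ((summable_expSeries k r hu).hasSum.neg).add (hasSum_weightSum k r hu)
      refine h1.congr_fun fun n => ?_
      linear_combination ((-1) ^ n * 2 ^ (r + 1) * Real.exp (-u * (2 * (n : ℝ) + 1 - r))) *
        mul_weightTerm_succ k r n
    rw [e] at hd
    exact hd
  · intro n v hv
    have hv : u / 2 < v := hv
    rcases lt_or_ge n r with hn | hn
    · rw [weightTerm_eq_zero hn]
      simp
      positivity
    · have h1 := le_two_mul_sub hn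
      have hr : (0 : ℝ) ≤ r := Nat.cast_nonneg r
      have hn0 : (0 : ℝ) ≤ n := Nat.cast_nonneg n
      have h2 : |2 * (n : ℝ) + 1 - r| ≤ 2 * n + 1 := by
        rw [abs_of_nonneg (by linarith)]; linarith
      simp only [norm_mul, norm_pow, norm_neg, norm_one, one_pow, one_mul, Real.norm_eq_abs,
        Nat.abs_ofNat, Real.abs_exp]
      have h3 : Real.exp (-v * (2 * (n : ℝ) + 1 - r)) ≤
          Real.exp (-(u / 2)) * Real.exp (-(u / 2)) ^ n := by
        refine le_trans ?_ (exp_neg_mul_le (half_pos hu).le hn)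
        rw [Real.exp_le_exp]
        nlinarith
      calc _ ≤ 2 ^ (r + 1) * C * ((Real.exp (-(u / 2)) * Real.exp (-(u / 2)) ^ n) *
            (2 * (n : ℝ) + 1)) := by
            gcongr
            exact h n
        _ = _ := by ring

/-! ### The integral representation of W -/

/-- The Gudermannian function. -/
def gd (u : ℝ) : ℝ :=
  Real.arctan (Real.sinh u)

theorem hasDerivAt_gd (u : ℝ) : HasDerivAt gd (1 / Real.cosh u) u := by
  have h := (Real.hasDerivAt_sinh u).arctan
  refine h.congr_deriv ?_
  have := Real.cosh_pos u
  rw [← Real.cosh_sq']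
  field_simp

theorem continuous_gd : Continuous gd :=
  Real.continuous_arctan.comp Real.continuous_sinh

theorem gd_zero : gd 0 = 0 := by simp [gd]

theorem gd_nonneg {u : ℝ} (hu : 0 ≤ u) : 0 ≤ gd u :=
  Real.arctan_nonneg.2 (Real.sinh_nonneg_iff.2 hu)

theorem abs_gd_le (u : ℝ) : |gd u| ≤ 2 := by
  have h1 := Real.arctan_lt_pi_div_two (Real.sinh u)
  have h2 := Real.neg_pi_div_two_lt_arctan (Real.sinh u)
  have := Real.pi_le_four
  rw [gd, abs_le]
  constructor <;> linarith

theorem one_div_cosh_le (u : ℝ) : 1 / Real.cosh u ≤ 2 * Real.exp (-u) := by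
  rw [div_le_iff₀ (Real.cosh_pos u), Real.cosh_eq]
  have : Real.exp (-u) * Real.exp u = 1 := by rw [← Real.exp_add]; simp
  nlinarith [Real.exp_pos (-u)]

/-- Shift of a sequence by one place to the right. -/
def shift (p : ℕ → ℝ) : ℕ → ℝ
  | 0 => 0
  | n + 1 => p n

/-- Both sides are coefficients of X · P(X) · Q(X): multiplication by the variable can be moved from
one factor to the other. -/
theorem sum_antidiagonal_shift (p q : ℕ → ℝ) (n : ℕ) :
    ∑ a ∈ Finset.HasAntidiagonal.antidiagonal n, shift p a.1 * q a.2 =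
      ∑ a ∈ Finset.HasAntidiagonal.antidiagonal n, p a.1 * shift q a.2 := by
  cases n with
  | zero => simp [shift]
  | succ n =>
    rw [Finset.Nat.sum_antidiagonal_succ, Finset.Nat.sum_antidiagonal_succ']
    simp [shift]

/-- `expSeries`, indexed by depth and by weight minus depth. -/
def excessSeries (i j : ℕ) (u : ℝ) : ℝ :=
  expSeries (i + j) i u

/-- `(-gd u) ^ a / a!` -/
def gdPow (u : ℝ) (a : ℕ) : ℝ :=
  (-gd u) ^ a / a.factorial

/-- `u ^ b / b!` -/
def argPow (u : ℝ) (b : ℕ) : ℝ :=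
  u ^ b / b.factorial

theorem hasDerivAt_argPow (b : ℕ) (u : ℝ) :
    HasDerivAt (fun v => argPow v b) (shift (argPow u) b) u := by
  cases b with
  | zero => simpa [argPow, shift] using hasDerivAt_const u (1 : ℝ)
  | succ b =>
    have h := ((hasDerivAt_id u).pow (b + 1)).div_const ((b + 1).factorial : ℝ)
    refine h.congr_deriv ?_
    simp only [shift, argPow, Nat.factorial_succ, id]
    push_cast
    field_simp

theorem hasDerivAt_gdPow (a : ℕ) (u : ℝ) :
    HasDerivAt (fun v => gdPow v a) (-(1 / Real.cosh u) * shift (gdPow u) a) u := by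
  cases a with
  | zero => simpa [gdPow, shift] using hasDerivAt_const u (1 : ℝ)
  | succ a =>
    have h := (((hasDerivAt_gd u).neg).pow (a + 1)).div_const ((a + 1).factorial : ℝ)
    refine h.congr_deriv ?_
    have := Real.cosh_pos u
    simp only [shift, gdPow, Nat.factorial_succ]
    push_cast
    field_simp
    simp

theorem expSeries_of_lt {k r : ℕ} (h : k < r) (u : ℝ) : expSeries k r u = 0 := by
  cases r with
  | zero => omega
  | succ r => simp [expSeries, weightTerm_of_le (show k ≤ r by omega)]

/-- For E(s, t) = ∑ `excessSeries i j` s^i t^j this reads E' = (-t + s / cosh u) E + t. The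
inhomogeneous term t compensates for depth 0, where E is the constant 1. -/
theorem hasDerivAt_excessSeries (i j : ℕ) {u : ℝ} (hu : 0 < u) :
    HasDerivAt (excessSeries i j)
      (-shift (fun j => excessSeries i j u) j +
        1 / Real.cosh u * shift (fun i => excessSeries i j u) i +
        (if i = 0 then shift (fun j => if j = 0 then 1 else 0) j else 0)) u := by
  rcases i with _ | i
  · have : excessSeries 0 j = fun _ => if j = 0 then 1 else 0 := by
      funext v
      simp [excessSeries, expSeries]
    rw [this]
    refine (hasDerivAt_const u (if j = 0 then (1 : ℝ) else 0)).congr_deriv ?_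
    rcases j with _ | j <;> simp [shift, excessSeries, expSeries]
  · have h := hasDerivAt_expSeries (i + j) i hu
    have e : excessSeries (i + 1) j = expSeries (i + j + 1) (i + 1) := by
      funext v
      rw [excessSeries, add_right_comm]
    rw [e]
    refine h.congr_deriv (Eq.symm ?_)
    rw [if_neg (Nat.succ_ne_zero i), add_zero]
    congr 1
    · rcases j with _ | j
      · simp [shift, expSeries_of_lt]
      · simp only [shift, excessSeries]
        rw [show i + 1 + j = i + (j + 1) by ring]
    · simp only [shift, excessSeries]
      ring

/-- The combination of the series `expSeries` whose derivative is elementary. -/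
def combined (r e : ℕ) (u : ℝ) : ℝ :=
  ∑ x ∈ Finset.HasAntidiagonal.antidiagonal r, ∑ y ∈ Finset.HasAntidiagonal.antidiagonal e,
    excessSeries x.1 y.1 u * gdPow u x.2 * argPow u y.2

/-- `combined` is the coefficient of s^r t^e in E exp(tu - s gd u). The exponential is an
integrating factor, so only t exp(tu - s gd u) survives. -/
theorem hasDerivAt_combined (r e : ℕ) {u : ℝ} (hu : 0 < u) :
    HasDerivAt (combined r e) (gdPow u r * shift (argPow u) e) u := by
  have h : HasDerivAt (combined r e)
      (∑ x ∈ Finset.HasAntidiagonal.antidiagonal r, ∑ y ∈ Finset.HasAntidiagonal.antidiagonal e,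
        (((-shift (fun j => excessSeries x.1 j u) y.1 +
          1 / Real.cosh u * shift (fun i => excessSeries i y.1 u) x.1 +
          (if x.1 = 0 then shift (fun j => if j = 0 then 1 else 0) y.1 else 0)) * gdPow u x.2 +
          excessSeries x.1 y.1 u * (-(1 / Real.cosh u) * shift (gdPow u) x.2)) * argPow u y.2 +
          excessSeries x.1 y.1 u * gdPow u x.2 * shift (argPow u) y.2)) u := by
    unfold combined
    refine HasDerivAt.fun_sum fun x _ => HasDerivAt.fun_sum fun y _ => ?_
    exact ((hasDerivAt_excessSeries x.1 y.1 hu).mul (hasDerivAt_gdPow x.2 u)).mul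
      (hasDerivAt_argPow y.2 u)
  refine h.congr_deriv (Eq.symm ?_)
  -- `e1` cancels the factor t and `e2` the factor s / cosh u against the derivatives of the
  -- exponential; `e3` evaluates the inhomogeneous part.
  have e1 : ∑ x ∈ Finset.HasAntidiagonal.antidiagonal r,
      ∑ y ∈ Finset.HasAntidiagonal.antidiagonal e,
        shift (fun j => excessSeries x.1 j u) y.1 * argPow u y.2 * gdPow u x.2 =
      ∑ x ∈ Finset.HasAntidiagonal.antidiagonal r,
      ∑ y ∈ Finset.HasAntidiagonal.antidiagonal e,
        excessSeries x.1 y.1 u * shift (argPow u) y.2 * gdPow u x.2 := by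
    refine Finset.sum_congr rfl fun x _ => ?_
    rw [← Finset.sum_mul, ← Finset.sum_mul, sum_antidiagonal_shift]
  have e2 : ∑ x ∈ Finset.HasAntidiagonal.antidiagonal r,
      ∑ y ∈ Finset.HasAntidiagonal.antidiagonal e,
        shift (fun i => excessSeries i y.1 u) x.1 * gdPow u x.2 * argPow u y.2 =
      ∑ x ∈ Finset.HasAntidiagonal.antidiagonal r,
      ∑ y ∈ Finset.HasAntidiagonal.antidiagonal e,
        excessSeries x.1 y.1 u * shift (gdPow u) x.2 * argPow u y.2 := by
    rw [Finset.sum_comm, Finset.sum_comm (s := Finset.HasAntidiagonal.antidiagonal r)]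
    refine Finset.sum_congr rfl fun y _ => ?_
    rw [← Finset.sum_mul, ← Finset.sum_mul, sum_antidiagonal_shift (fun i => excessSeries i y.1 u)]
  have e3 : ∑ x ∈ Finset.HasAntidiagonal.antidiagonal r,
      ∑ y ∈ Finset.HasAntidiagonal.antidiagonal e,
        (if x.1 = 0 then shift (fun j => if j = 0 then 1 else 0) y.1 else 0) * gdPow u x.2 *
          argPow u y.2 = gdPow u r * shift (argPow u) e := by
    have e4 : ∀ x ∈ Finset.HasAntidiagonal.antidiagonal r,
        ∑ y ∈ Finset.HasAntidiagonal.antidiagonal e,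
          (if x.1 = 0 then shift (fun j => if j = 0 then 1 else 0) y.1 else 0) * gdPow u x.2 *
            argPow u y.2 =
        (if x.1 = 0 then 1 else 0) * gdPow u x.2 * shift (argPow u) e := by
      intro x _
      split_ifs
      · have := sum_antidiagonal_shift (fun j => if j = 0 then 1 else 0) (argPow u) e
        calc _ = gdPow u x.2 * ∑ y ∈ Finset.HasAntidiagonal.antidiagonal e,
              shift (fun j => if j = 0 then 1 else 0) y.1 * argPow u y.2 := by
              rw [Finset.mul_sum]
              exact Finset.sum_congr rfl fun y _ => by ring
          _ = _ := by
              rw [this, Finset.Nat.sum_antidiagonal_eq_sum_range_succ_mk, Finset.sum_range_succ']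
              simp
      · simp
    rw [Finset.sum_congr rfl e4, Finset.Nat.sum_antidiagonal_eq_sum_range_succ_mk,
      Finset.sum_range_succ']
    simp
  rw [← e3, ← sub_eq_zero, ← Finset.sum_sub_distrib]
  simp only [← Finset.sum_sub_distrib]
  have e5 := congrArg₂ (fun a b => a - 1 / Real.cosh u * b) (sub_eq_zero.2 e1) (sub_eq_zero.2 e2)
  simp only [mul_zero, sub_zero] at e5
  rw [← e5]
  simp only [← Finset.sum_sub_distrib, Finset.mul_sum]
  refine Finset.sum_congr rfl fun x _ => Finset.sum_congr rfl fun y _ => ?_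
  ring

/-- The part of `combined (r + 1) e` of positive depth. -/
def reduced (r e : ℕ) (u : ℝ) : ℝ :=
  ∑ x ∈ Finset.HasAntidiagonal.antidiagonal r, ∑ y ∈ Finset.HasAntidiagonal.antidiagonal e,
    excessSeries (x.1 + 1) y.1 u * gdPow u x.2 * argPow u y.2

theorem combined_succ (r e : ℕ) (u : ℝ) :
    combined (r + 1) e u = gdPow u (r + 1) * argPow u e + reduced r e u := by
  rw [combined, Finset.Nat.sum_antidiagonal_succ, reduced]
  congr 1
  rw [Finset.Nat.sum_antidiagonal_eq_sum_range_succ_mk, Finset.sum_range_succ']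
  simp [excessSeries, expSeries]

/-- Removing depth 0 subtracts gd^(r+1) u^e with its coefficient; its derivative cancels the term
from differentiating u^e, leaving the one from gd. -/
theorem hasDerivAt_reduced (r e : ℕ) {u : ℝ} (hu : 0 < u) :
    HasDerivAt (reduced r e) (1 / Real.cosh u * gdPow u r * argPow u e) u := by
  have h := (hasDerivAt_combined (r + 1) e hu).sub
    ((hasDerivAt_gdPow (r + 1) u).mul (hasDerivAt_argPow e u))
  have e1 : reduced r e = combined (r + 1) e - (fun v => gdPow v (r + 1)) * fun v => argPow v e := by
    funext v
    simp [combined_succ]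
  rw [e1]
  refine h.congr_deriv ?_
  simp only [shift]
  ring

theorem abs_gdPow_le (a : ℕ) (u : ℝ) : |gdPow u a| ≤ 2 ^ a := by
  rw [gdPow, abs_div, abs_pow, abs_neg, Nat.abs_cast]
  refine (div_le_self (by positivity) (by exact_mod_cast Nat.factorial_pos a)).trans ?_
  exact pow_le_pow_left₀ (abs_nonneg _) (abs_gd_le u) a

theorem tendsto_reduced_atTop (r e : ℕ) : Tendsto (reduced r e) atTop (𝓝 0) := by
  have : Tendsto (reduced r e) atTop (𝓝 (∑ x ∈ Finset.HasAntidiagonal.antidiagonal r,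
      ∑ y ∈ Finset.HasAntidiagonal.antidiagonal e, 0)) := by
    refine tendsto_finsetSum _ fun x _ => tendsto_finsetSum _ fun y _ => ?_
    obtain ⟨C, hC, h⟩ := exists_abs_expSeries_le (x.1 + 1 + y.1) x.1
    have h1 := (Real.tendsto_pow_mul_exp_neg_atTop_nhds_zero y.2).const_mul (C * 2 ^ x.2)
    rw [mul_zero] at h1
    refine squeeze_zero_norm' ?_ h1
    filter_upwards [eventually_ge_atTop 1] with u hu
    rw [norm_mul, norm_mul, Real.norm_eq_abs, Real.norm_eq_abs, Real.norm_eq_abs]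
    have h2 : |argPow u y.2| ≤ u ^ y.2 := by
      rw [argPow, abs_of_nonneg (by positivity)]
      exact div_le_self (by positivity) (by exact_mod_cast Nat.factorial_pos _)
    have h3 : |excessSeries (x.1 + 1) y.1 u| ≤ C * Real.exp (-u) := by
      rw [excessSeries]
      exact h u hu
    calc _ ≤ C * Real.exp (-u) * 2 ^ x.2 * u ^ y.2 := by
          gcongr
          exact abs_gdPow_le _ _
      _ = _ := by ring
  simpa using this

theorem tendsto_gdPow_zero (a : ℕ) :
    Tendsto (fun u => gdPow u a) (𝓝[>] 0) (𝓝 (if a = 0 then 1 else 0)) := by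
  have : Continuous fun u => gdPow u a := by
    have := continuous_gd
    unfold gdPow
    fun_prop
  refine (this.tendsto' 0 _ ?_).mono_left nhdsWithin_le_nhds
  rcases a with _ | a <;> simp [gdPow, gd_zero]

theorem tendsto_argPow_zero (a : ℕ) :
    Tendsto (fun u => argPow u a) (𝓝[>] 0) (𝓝 (if a = 0 then 1 else 0)) := by
  have : Continuous fun u => argPow u a := by
    unfold argPow
    fun_prop
  refine (this.tendsto' 0 _ ?_).mono_left nhdsWithin_le_nhds
  rcases a with _ | a <;> simp [argPow]

/-- Positive powers of gd u and of u vanish at 0, so only the summand of full depth and full excess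
remains. -/
theorem tendsto_reduced_zero (r e : ℕ) :
    Tendsto (reduced r e) (𝓝[>] 0) (𝓝 (W (r + 1 + e) (r + 1))) := by
  have : Tendsto (reduced r e) (𝓝[>] 0) (𝓝 (∑ x ∈ Finset.HasAntidiagonal.antidiagonal r,
      ∑ y ∈ Finset.HasAntidiagonal.antidiagonal e, W (x.1 + 1 + y.1) (x.1 + 1) *
        (if x.2 = 0 then 1 else 0) * (if y.2 = 0 then 1 else 0))) := by
    refine tendsto_finsetSum _ fun x _ => tendsto_finsetSum _ fun y _ => ?_
    exact ((tendsto_expSeries_nhdsWithin_zero _ _).mul (tendsto_gdPow_zero _)).mul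
      (tendsto_argPow_zero _)
  rw [Finset.sum_eq_single (r, 0), Finset.sum_eq_single (e, 0)] at this
  · simpa using this
  · rintro ⟨a, b⟩ h h'
    have : b ≠ 0 := by
      rintro rfl
      simp_all
    simp [this]
  · simp
  · rintro ⟨a, b⟩ h h'
    have : b ≠ 0 := by
      rintro rfl
      simp_all
    simp [this]
  · simp

/-- The integral of `gd ^ a / a! * u ^ b / b!` against `1 / cosh u`. -/
def gdIntegral (a b : ℕ) : ℝ :=
  ∫ u in Set.Ioi (0 : ℝ), gd u ^ a / a.factorial * (u ^ b / b.factorial) * (1 / Real.cosh u)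

theorem integrableOn_of_abs_le_exp {f : ℝ → ℝ} (hf : ContinuousOn f (Set.Ioi 0)) {C c : ℝ}
    (hc : 0 < c) (h : ∀ u : ℝ, 0 < u → |f u| ≤ C * Real.exp (-c * u)) :
    MeasureTheory.IntegrableOn f (Set.Ioi 0) := by
  refine MeasureTheory.Integrable.mono' ((integrableOn_exp_mul_Ioi (neg_neg_of_pos hc) 0).const_mul C)
    (hf.aestronglyMeasurable measurableSet_Ioi) ?_
  filter_upwards [MeasureTheory.ae_restrict_mem measurableSet_Ioi] with u hu
  exact h u hu

theorem argPow_mul_exp_le (b : ℕ) {u : ℝ} (hu : 0 ≤ u) :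
    argPow u b * Real.exp (-u) ≤ 2 ^ b * Real.exp (-(1 / 2) * u) := by
  have h1 : (u / 2) ^ b / b.factorial ≤ Real.exp (u / 2) :=
    Real.pow_div_factorial_le_exp (u / 2) (by linarith) b
  have h2 : argPow u b = 2 ^ b * ((u / 2) ^ b / b.factorial) := by
    rw [argPow, div_pow]
    field_simp
  have h3 : Real.exp (-(1 / 2) * u) = Real.exp (u / 2) * Real.exp (-u) := by
    rw [← Real.exp_add]; congr 1; ring
  rw [h2, h3, ← mul_assoc]
  gcongr

theorem integrableOn_gdPow_mul_argPow (a b : ℕ) :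
    MeasureTheory.IntegrableOn (fun u => 1 / Real.cosh u * gdPow u a * argPow u b) (Set.Ioi 0) := by
  refine integrableOn_of_abs_le_exp (C := 2 * 2 ^ a * 2 ^ b) (c := 1 / 2) ?_ (by norm_num)
    fun u hu => ?_
  · have := continuous_gd
    have h2 : ∀ u, Real.cosh u ≠ 0 := fun u => (Real.cosh_pos u).ne'
    unfold gdPow argPow
    exact Continuous.continuousOn (by fun_prop (disch := exact h2))
  · have hb : 0 ≤ argPow u b := by unfold argPow; positivity
    have hc := Real.cosh_pos u
    rw [abs_mul, abs_mul, abs_of_nonneg hb, abs_of_nonneg (by positivity)]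
    calc _ ≤ 2 * Real.exp (-u) * 2 ^ a * argPow u b := by
          gcongr
          · exact one_div_cosh_le u
          · exact abs_gdPow_le a u
      _ = 2 * 2 ^ a * (argPow u b * Real.exp (-u)) := by ring
      _ ≤ 2 * 2 ^ a * (2 ^ b * Real.exp (-(1 / 2) * u)) := by
          gcongr ?_ * ?_
          exact argPow_mul_exp_le b (le_of_lt hu)
      _ = _ := by ring

theorem W_eq_gdIntegral (r e : ℕ) :
    W (r + 1 + e) (r + 1) = (-1) ^ (r + 1) * gdIntegral r e := by
  set L := W (r + 1 + e) (r + 1)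
  -- The fundamental theorem needs continuity at the endpoint, so the value at 0 is redefined to be
  -- the one-sided limit W.
  have hne : ∀ u : ℝ, 0 < u → Function.update (reduced r e) 0 L =ᶠ[𝓝 u] reduced r e := by
    intro u hu
    filter_upwards [lt_mem_nhds hu] with v hv
    exact Function.update_of_ne (ne_of_gt hv) _ _
  have h := MeasureTheory.integral_Ioi_of_hasDerivAt_of_tendsto
    (f := Function.update (reduced r e) 0 L) (a := 0) (m := 0) ?_
    (fun u hu => (hasDerivAt_reduced r e hu).congr_of_eventuallyEq (hne u hu))
    (integrableOn_gdPow_mul_argPow r e) ?_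
  · rw [Function.update_self, zero_sub] at h
    have h2 : ∫ u in Set.Ioi (0 : ℝ), 1 / Real.cosh u * gdPow u r * argPow u e =
        (-1) ^ r * gdIntegral r e := by
      rw [gdIntegral, ← MeasureTheory.integral_const_mul]
      refine MeasureTheory.integral_congr_ae (Eventually.of_forall fun u => ?_)
      simp only [gdPow, argPow, neg_pow (gd u)]
      ring
    rw [h2] at h
    rw [pow_succ]
    linarith
  · rw [← continuousWithinAt_Ioi_iff_Ici, continuousWithinAt_update_same,
      Set.sdiff_singleton_eq_self (by simp)]
    exact tendsto_reduced_zero r e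
  · refine (tendsto_reduced_atTop r e).congr' ?_
    filter_upwards [eventually_gt_atTop 0] with v hv
    exact (Function.update_of_ne (ne_of_gt hv) _ _).symm

/-! ### The contour integrand on the half-strip -/

/-- The function `tanh (w / 2)`. -/
def tanhHalf (w : ℂ) : ℂ :=
  (Complex.exp w - 1) / (Complex.exp w + 1)

theorem normSq_exp_add_one (w : ℂ) :
    Complex.normSq (Complex.exp w + 1) =
      Real.exp w.re ^ 2 + 2 * (Real.exp w.re * Real.cos w.im) + 1 := by
  rw [Complex.normSq_apply]
  simp only [Complex.add_re, Complex.add_im, Complex.exp_re, Complex.exp_im, Complex.one_re,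
    Complex.one_im]
  linear_combination Real.exp w.re ^ 2 * Real.sin_sq_add_cos_sq w.im

theorem normSq_exp_sub_one (w : ℂ) :
    Complex.normSq (Complex.exp w - 1) =
      Real.exp w.re ^ 2 - 2 * (Real.exp w.re * Real.cos w.im) + 1 := by
  rw [Complex.normSq_apply]
  simp only [Complex.sub_re, Complex.sub_im, Complex.exp_re, Complex.exp_im, Complex.one_re,
    Complex.one_im]
  linear_combination Real.exp w.re ^ 2 * Real.sin_sq_add_cos_sq w.im

section strip

variable {w : ℂ}

theorem cos_im_nonneg (h0 : 0 ≤ w.im) (h1 : w.im ≤ Real.pi / 2) : 0 ≤ Real.cos w.im :=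
  Real.cos_nonneg_of_neg_pi_div_two_le_of_le (by linarith [Real.pi_pos]) h1

theorem sin_im_nonneg (h0 : 0 ≤ w.im) (h1 : w.im ≤ Real.pi / 2) : 0 ≤ Real.sin w.im :=
  Real.sin_nonneg_of_nonneg_of_le_pi h0 (by linarith [Real.pi_pos])

theorem exp_add_one_ne_zero (h0 : 0 ≤ w.im) (h1 : w.im ≤ Real.pi / 2) :
    Complex.exp w + 1 ≠ 0 := by
  intro h
  have := congrArg Complex.re h
  simp only [Complex.add_re, Complex.exp_re, Complex.one_re, Complex.zero_re] at this
  have := mul_nonneg (Real.exp_pos w.re).le (cos_im_nonneg h0 h1)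
  linarith

theorem tanhHalf_eq (h0 : 0 ≤ w.im) (h1 : w.im ≤ Real.pi / 2) :
    tanhHalf w = ((Real.exp w.re ^ 2 - 1 : ℝ) + (2 * Real.exp w.re * Real.sin w.im : ℝ) * Complex.I) /
      (Complex.normSq (Complex.exp w + 1) : ℝ) := by
  have h := exp_add_one_ne_zero h0 h1
  have h2 : (Complex.normSq (Complex.exp w + 1) : ℂ) ≠ 0 := by
    exact_mod_cast (Complex.normSq_pos.2 h).ne'
  rw [tanhHalf, div_eq_div_iff h h2, Complex.normSq_eq_conj_mul_self]
  rw [show ∀ a b c : ℂ, a * (b * c) = (a * b) * c from fun a b c => by ring]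
  congr 1
  apply Complex.ext
  · simp [Complex.exp_re, Complex.exp_im]
    simp only [← Complex.ofReal_exp, Complex.ofReal_re, ← Complex.ofReal_pow]
    linear_combination Real.exp w.re ^ 2 * Real.sin_sq_add_cos_sq w.im
  · simp [Complex.exp_re, Complex.exp_im]
    simp only [← Complex.ofReal_exp, ← Complex.ofReal_sin, Complex.ofReal_re, Complex.ofReal_im,
      ← Complex.ofReal_pow]
    ring

/-- The real part has the sign of exp(2 Re w) - 1 and the imaginary part that of sin(Im w). Hence
the principal power is holomorphic up to the boundary, the corner 0 excepted. -/
theorem tanhHalf_mem_slitPlane (h0 : 0 ≤ w.im) (h1 : w.im ≤ Real.pi / 2)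
    (h : 0 < w.re ∨ (0 ≤ w.re ∧ 0 < w.im)) : tanhHalf w ∈ Complex.slitPlane := by
  have hpos : 0 < Complex.normSq (Complex.exp w + 1) :=
    Complex.normSq_pos.2 (exp_add_one_ne_zero h0 h1)
  rw [tanhHalf_eq h0 h1, Complex.mem_slitPlane_iff, Complex.div_ofReal_re, Complex.div_ofReal_im]
  rcases h with h | ⟨-, h⟩
  · left
    refine div_pos ?_ hpos
    rw [Complex.add_re, Complex.ofReal_re, Complex.re_ofReal_mul, Complex.I_re, mul_zero, add_zero,
      sub_pos]
    exact one_lt_pow₀ (by simpa using h) two_ne_zero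
  · right
    refine (div_pos ?_ hpos).ne'
    have h3 := Real.sin_pos_of_pos_of_lt_pi h (by linarith [Real.pi_pos])
    have := mul_pos (Real.exp_pos w.re) h3
    rw [Complex.add_im, Complex.ofReal_im, zero_add, Complex.im_ofReal_mul, Complex.I_im, mul_one]
    linarith

theorem norm_tanhHalf_le_one (h0 : 0 ≤ w.im) (h1 : w.im ≤ Real.pi / 2) : ‖tanhHalf w‖ ≤ 1 := by
  have hne : 0 < ‖Complex.exp w + 1‖ := norm_pos_iff.2 (exp_add_one_ne_zero h0 h1)
  rw [tanhHalf, norm_div, div_le_one hne]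
  refine le_of_sq_le_sq ?_ hne.le
  rw [← Complex.normSq_eq_norm_sq, ← Complex.normSq_eq_norm_sq, normSq_exp_add_one,
    normSq_exp_sub_one]
  have := mul_nonneg (Real.exp_pos w.re).le (cos_im_nonneg h0 h1)
  linarith

/-- The numerator has imaginary part exp(Re w) sin(Im w) ≥ Im w / 2 by Jordan's inequality, and the
denominator is at most e + 1 ≤ 4. -/
theorem le_norm_tanhHalf (h0 : 0 ≤ w.im) (h1 : w.im ≤ Real.pi / 2) (h2 : 0 ≤ w.re)
    (h3 : w.re ≤ 1) : w.im / 8 ≤ ‖tanhHalf w‖ := by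
  have hne : 0 < ‖Complex.exp w + 1‖ := norm_pos_iff.2 (exp_add_one_ne_zero h0 h1)
  rw [tanhHalf, norm_div, le_div_iff₀ hne]
  have h4 : ‖Complex.exp w + 1‖ ≤ 4 := by
    refine (norm_add_le _ _).trans ?_
    rw [Complex.norm_exp, norm_one]
    have := Real.exp_one_lt_d9
    have : Real.exp w.re ≤ Real.exp 1 := Real.exp_le_exp.2 h3
    linarith
  have h5 : w.im / 2 ≤ ‖Complex.exp w - 1‖ := by
    refine le_trans ?_ ((le_abs_self _).trans (Complex.abs_im_le_norm _))
    simp only [Complex.sub_im, Complex.exp_im, Complex.one_im, sub_zero]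
    have h6 := Real.mul_le_sin h0 h1
    have h7 : 1 ≤ Real.exp w.re := by simpa using h2
    have h8 := sin_im_nonneg h0 h1
    have h9 : w.im / 2 ≤ 2 / Real.pi * w.im := by
      have : 1 / 2 ≤ 2 / Real.pi := by
        rw [div_le_div_iff₀ (by norm_num) Real.pi_pos]
        linarith [Real.pi_le_four]
      nlinarith
    nlinarith
  nlinarith

theorem norm_tanhHalf_sub_one_le (h0 : 0 ≤ w.im) (h1 : w.im ≤ Real.pi / 2) :
    ‖tanhHalf w - 1‖ ≤ 2 * Real.exp (-w.re) := by
  have h := exp_add_one_ne_zero h0 h1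
  have hne : 0 < ‖Complex.exp w + 1‖ := norm_pos_iff.2 h
  have e : tanhHalf w - 1 = -2 / (Complex.exp w + 1) := by
    rw [tanhHalf, div_sub_one h]
    congr 1
    ring
  have h4 : Real.exp w.re ≤ ‖Complex.exp w + 1‖ := by
    refine le_of_sq_le_sq ?_ hne.le
    rw [← Complex.normSq_eq_norm_sq, normSq_exp_add_one]
    have := mul_nonneg (Real.exp_pos w.re).le (cos_im_nonneg h0 h1)
    linarith
  rw [e, norm_div, norm_neg, Complex.norm_ofNat, Real.exp_neg, ← div_eq_mul_inv]
  gcongr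

end strip

/-- The integrand of the contour integral. -/
def contourFun (x y : ℝ) (w : ℂ) : ℂ :=
  Complex.exp (x * w) * (tanhHalf w ^ (y : ℂ) - 1)

theorem differentiableAt_contourFun (x y : ℝ) {w : ℂ} (h0 : 0 ≤ w.im) (h1 : w.im ≤ Real.pi / 2)
    (h : 0 < w.re ∨ (0 ≤ w.re ∧ 0 < w.im)) : DifferentiableAt ℂ (contourFun x y) w := by
  have h2 : DifferentiableAt ℂ tanhHalf w := by
    have := exp_add_one_ne_zero h0 h1
    unfold tanhHalf
    fun_prop (disch := assumption)
  have h3 := h2.cpow_const (c := (y : ℂ)) (tanhHalf_mem_slitPlane h0 h1 h)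
  unfold contourFun
  fun_prop

/-- A majorant uniform in Re w, with a singularity at the corner that is integrable in Im w when |y|
< 1. -/
theorem norm_contourFun_le_of_re_le_one {x y : ℝ} (hx : |x| < 1) {w : ℂ} (h0 : 0 < w.im)
    (h1 : w.im ≤ Real.pi / 2) (h2 : 0 ≤ w.re) (h3 : w.re ≤ 1) :
    ‖contourFun x y w‖ ≤ Real.exp 1 * ((w.im / 8) ^ (-|y|) + 1) := by
  rw [contourFun, norm_mul, Complex.norm_exp]
  have e1 : ((x : ℂ) * w).re = x * w.re := by simp
  rw [e1]
  have h4 := le_norm_tanhHalf h0.le h1 h2 h3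
  have h5 := norm_tanhHalf_le_one h0.le h1
  have h6 : 0 < w.im / 8 := by positivity
  have h7 : 0 < ‖tanhHalf w‖ := h6.trans_le h4
  have h8 : ‖tanhHalf w ^ (y : ℂ)‖ ≤ (w.im / 8) ^ (-|y|) := by
    rw [Complex.norm_cpow_real]
    calc ‖tanhHalf w‖ ^ y ≤ ‖tanhHalf w‖ ^ (-|y|) :=
          Real.rpow_le_rpow_of_exponent_ge h7 h5 (neg_abs_le y)
      _ ≤ (w.im / 8) ^ (-|y|) :=
          Real.rpow_le_rpow_of_nonpos h6 h4 (neg_nonpos.2 (abs_nonneg y))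
  have h9 : x * w.re ≤ 1 := by
    have := (abs_lt.1 hx).2
    nlinarith
  gcongr
  refine (norm_sub_le _ _).trans ?_
  rw [norm_one]
  gcongr

/-- For Re w ≥ 2 the distance of tanh(w/2) from 1 is at most 2 exp(-Re w) ≤ 1/3. The logarithm costs
a factor 3/2 and the exponential a factor 2, which makes 6. Subtracting 1 in the integrand is what
produces this decay. -/
theorem norm_contourFun_le_of_two_le {x y : ℝ} (hy : |y| < 1) {w : ℂ} (h0 : 0 ≤ w.im)
    (h1 : w.im ≤ Real.pi / 2) (h2 : 2 ≤ w.re) :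
    ‖contourFun x y w‖ ≤ 6 * Real.exp (-(1 - x) * w.re) := by
  have hs := tanhHalf_mem_slitPlane h0 h1 (Or.inl (by linarith))
  have h3 := norm_tanhHalf_sub_one_le h0 h1
  have h4 : Real.exp (-w.re) ≤ 1 / 6 := by
    have h5 : Real.exp (-w.re) ≤ Real.exp (-2) := Real.exp_le_exp.2 (by linarith)
    have h6 : Real.exp (-2) = (Real.exp 1 * Real.exp 1)⁻¹ := by
      rw [← Real.exp_add, ← Real.exp_neg]; norm_num
    have h7 := Real.exp_one_gt_d9
    have h8 : (Real.exp 1 * Real.exp 1)⁻¹ ≤ 1 / 6 := by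
      rw [inv_le_comm₀ (by positivity) (by norm_num)]
      nlinarith
    linarith
  have h5 : ‖Complex.log (tanhHalf w)‖ ≤ 3 * Real.exp (-w.re) := by
    have := Complex.norm_log_one_add_half_le_self (z := tanhHalf w - 1) (by linarith)
    rw [add_sub_cancel] at this
    linarith
  have h6 : ‖Complex.log (tanhHalf w) * y‖ ≤ 3 * Real.exp (-w.re) := by
    rw [norm_mul, Complex.norm_real, Real.norm_eq_abs]
    nlinarith [norm_nonneg (Complex.log (tanhHalf w))]
  have h7 : ‖tanhHalf w ^ (y : ℂ) - 1‖ ≤ 6 * Real.exp (-w.re) := by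
    rw [Complex.cpow_def_of_ne_zero (Complex.slitPlane_ne_zero hs)]
    refine (Complex.norm_exp_sub_one_le (by linarith)).trans ?_
    linarith
  rw [contourFun, norm_mul, Complex.norm_exp]
  have e1 : ((x : ℂ) * w).re = x * w.re := by simp
  have e2 : Real.exp (-(1 - x) * w.re) = Real.exp (x * w.re) * Real.exp (-w.re) := by
    rw [← Real.exp_add]; congr 1; ring
  rw [e1, e2]
  calc _ ≤ Real.exp (x * w.re) * (6 * Real.exp (-w.re)) := by gcongr
    _ = _ := by ring

/-! ### Boundary values and Cauchy's theorem -/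

/-- The complement `π / 2 - gd u`. -/
def coGd (u : ℝ) : ℝ :=
  Real.pi / 2 - gd u

theorem cos_gd (u : ℝ) : Real.cos (gd u) = 1 / Real.cosh u := by
  rw [gd, Real.cos_arctan, ← Real.cosh_sq', Real.sqrt_sq (Real.cosh_pos u).le]

theorem sin_gd (u : ℝ) : Real.sin (gd u) = Real.sinh u / Real.cosh u := by
  rw [gd, Real.sin_arctan, ← Real.cosh_sq', Real.sqrt_sq (Real.cosh_pos u).le]

theorem coGd_pos (u : ℝ) : 0 < coGd u := sub_pos.2 (Real.arctan_lt_pi_div_two _)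

theorem coGd_le {u : ℝ} (hu : 0 ≤ u) : coGd u ≤ Real.pi / 2 := by
  rw [coGd]; linarith [gd_nonneg hu]

theorem contourFun_ofReal_im (x y : ℝ) {u : ℝ} (hu : 0 < u) : (contourFun x y u).im = 0 := by
  have e : contourFun x y u = ((Real.exp (x * u) *
      (((Real.exp u - 1) / (Real.exp u + 1)) ^ y - 1) : ℝ) : ℂ) := by
    rw [contourFun, tanhHalf]
    have : 0 ≤ (Real.exp u - 1) / (Real.exp u + 1) := by
      have : 1 ≤ Real.exp u := by simpa using hu.le
      exact div_nonneg (by linarith) (by linarith)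
    push_cast [Complex.ofReal_cpow this]
    rfl
  rw [e, Complex.ofReal_im]

theorem tanhHalf_top (u : ℝ) :
    tanhHalf (u + (Real.pi / 2 : ℝ) * Complex.I) = Complex.exp (coGd u * Complex.I) := by
  have him : (u + (Real.pi / 2 : ℝ) * Complex.I).im = Real.pi / 2 := by simp
  have hre : (u + (Real.pi / 2 : ℝ) * Complex.I).re = u := by simp
  rw [tanhHalf_eq (by rw [him]; positivity) him.le, normSq_exp_add_one, him, hre,
    Complex.exp_mul_I, ← Complex.ofReal_cos, ← Complex.ofReal_sin, coGd, Real.cos_pi_div_two_sub,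
    Real.sin_pi_div_two_sub, sin_gd, cos_gd, Real.cos_pi_div_two, Real.sin_pi_div_two,
    Real.sinh_eq, Real.cosh_eq]
  have : Real.exp u * Real.exp (-u) = 1 := by rw [← Real.exp_add]; simp
  have h2 : Real.exp (-u) = 1 / Real.exp u := by field_simp; linarith
  rw [h2]
  have h3 := Real.exp_pos u
  have h4 : Real.exp u ^ 2 + 1 ≠ 0 := by positivity
  have e1 : (Real.exp u - 1 / Real.exp u) / 2 / ((Real.exp u + 1 / Real.exp u) / 2) =
      (Real.exp u ^ 2 - 1) / (Real.exp u ^ 2 + 1) := by field_simp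
  have e2 : 1 / ((Real.exp u + 1 / Real.exp u) / 2) = 2 * Real.exp u / (Real.exp u ^ 2 + 1) := by
    field_simp
  rw [e1, e2]
  push_cast
  ring

theorem contourFun_top_im (x y : ℝ) {u : ℝ} (hu : 0 ≤ u) :
    (contourFun x y (u + (Real.pi / 2 : ℝ) * Complex.I)).im =
      Real.exp (x * u) *
        (Real.sin (Real.pi / 2 * x + y * coGd u) - Real.sin (Real.pi / 2 * x)) := by
  have h1 := coGd_pos u
  have h2 := coGd_le hu
  have hlog : Complex.log (Complex.exp (coGd u * Complex.I)) = coGd u * Complex.I := by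
    rw [Complex.log_exp] <;> simp <;> linarith [Real.pi_pos]
  rw [contourFun, tanhHalf_top, Complex.cpow_def_of_ne_zero (Complex.exp_ne_zero _), hlog, mul_sub,
    ← Complex.exp_add, mul_one, Complex.sub_im, Complex.exp_im, Complex.exp_im]
  simp
  ring_nf

theorem contourFun_left_re (x y : ℝ) {b : ℝ} (h0 : 0 < b) (h1 : b ≤ Real.pi / 2) :
    (contourFun x y (b * Complex.I)).re =
      Real.tan (b / 2) ^ y * Real.cos (x * b + Real.pi / 2 * y) - Real.cos (x * b) := by
  have hpi := Real.pi_pos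
  have ht : 0 < Real.tan (b / 2) := Real.tan_pos_of_pos_of_lt_pi_div_two (by linarith) (by linarith)
  have hc : 0 < Real.cos (b / 2) := Real.cos_pos_of_mem_Ioo ⟨by linarith, by linarith⟩
  have e : tanhHalf (b * Complex.I) = (Real.tan (b / 2) : ℂ) * Complex.I := by
    have him : ((b : ℂ) * Complex.I).im = b := by simp
    have hre : ((b : ℂ) * Complex.I).re = 0 := by simp
    rw [tanhHalf_eq (by rw [him]; exact h0.le) (him.le.trans h1), normSq_exp_add_one, him, hre,
      Real.exp_zero, Real.tan_eq_sin_div_cos]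
    have h3 : Real.sin b = 2 * Real.sin (b / 2) * Real.cos (b / 2) := by
      rw [← Real.sin_two_mul]; congr 1; ring
    have h4 : Real.cos b = 2 * Real.cos (b / 2) ^ 2 - 1 := by
      rw [← Real.cos_two_mul]; congr 1; ring
    have h5 : 2 * 1 * Real.sin b / ((1 : ℝ) ^ 2 + 2 * (1 * Real.cos b) + 1) =
        Real.sin (b / 2) / Real.cos (b / 2) := by
      rw [h3, h4, show (1 : ℝ) ^ 2 + 2 * (1 * (2 * Real.cos (b / 2) ^ 2 - 1)) + 1 =
        4 * Real.cos (b / 2) ^ 2 by ring, div_eq_div_iff (by positivity) hc.ne']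
      ring
    rw [← h5]
    push_cast
    ring
  have hlog : Complex.log ((Real.tan (b / 2) : ℂ) * Complex.I) =
      Real.log (Real.tan (b / 2)) + Real.pi / 2 * Complex.I := by
    rw [Complex.log_ofReal_mul ht Complex.I_ne_zero, Complex.log_I]
  have hne : (Real.tan (b / 2) : ℂ) * Complex.I ≠ 0 :=
    mul_ne_zero (by exact_mod_cast ht.ne') Complex.I_ne_zero
  rw [contourFun, e, Complex.cpow_def_of_ne_zero hne, hlog, mul_sub, ← Complex.exp_add, mul_one,
    Complex.sub_re, Complex.exp_re, Complex.exp_re, Real.rpow_def_of_pos ht]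
  simp

/-- The imaginary part of `contourFun x y` on the line `Im w = π / 2`. -/
def topFun (x y u : ℝ) : ℝ :=
  Real.exp (x * u) * (Real.sin (Real.pi / 2 * x + y * coGd u) - Real.sin (Real.pi / 2 * x))

/-- The real part of `contourFun x y` on the line `Re w = 0`. -/
def leftFun (x y b : ℝ) : ℝ :=
  Real.tan (b / 2) ^ y * Real.cos (x * b + Real.pi / 2 * y) - Real.cos (x * b)

theorem continuous_coGd : Continuous coGd := continuous_const.sub continuous_gd

theorem continuous_topFun (x y : ℝ) : Continuous (topFun x y) := by
  have := continuous_coGd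
  unfold topFun
  fun_prop

theorem continuousOn_contourFun_horizontal (x y : ℝ) {b ε R : ℝ} (hε : 0 < ε) (hR : ε ≤ R)
    (h0 : 0 ≤ b) (h1 : b ≤ Real.pi / 2) :
    ContinuousOn (fun t : ℝ => contourFun x y (t + b * Complex.I)) (Set.uIcc ε R) := by
  intro t ht
  rw [Set.uIcc_of_le hR] at ht
  refine ContinuousAt.continuousWithinAt ?_
  have h := (differentiableAt_contourFun x y (w := t + b * Complex.I) (by simpa using h0)
    (by simpa using h1) (Or.inl (by simpa using hε.trans_le ht.1))).continuousAt
  exact ContinuousAt.comp (f := fun t : ℝ => (t : ℂ) + b * Complex.I) h (by fun_prop)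

theorem continuousOn_contourFun_vertical (x y : ℝ) {a : ℝ} (ha : 0 < a) :
    ContinuousOn (fun t : ℝ => contourFun x y (a + t * Complex.I)) (Set.uIcc 0 (Real.pi / 2)) := by
  intro t ht
  rw [Set.uIcc_of_le (by positivity)] at ht
  refine ContinuousAt.continuousWithinAt ?_
  have h := (differentiableAt_contourFun x y (w := a + t * Complex.I) (by simpa using ht.1)
    (by simpa using ht.2) (Or.inl (by simpa using ha))).continuousAt
  exact ContinuousAt.comp (f := fun t : ℝ => (a : ℂ) + t * Complex.I) h (by fun_prop)

/-- The imaginary part of Cauchy's theorem on the rectangle from ε to R + iπ/2; the bottom edge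
drops out because the integrand is real there. -/
theorem integral_topFun_eq (x y : ℝ) {ε R : ℝ} (hε : 0 < ε) (hR : ε ≤ R) :
    ∫ u in ε..R, topFun x y u =
      (∫ b in (0 : ℝ)..Real.pi / 2, (contourFun x y (R + b * Complex.I)).re) -
        ∫ b in (0 : ℝ)..Real.pi / 2, (contourFun x y (ε + b * Complex.I)).re := by
  have hpi : 0 ≤ Real.pi / 2 := by positivity
  have h := Complex.integral_boundary_rect_eq_zero_of_differentiableOn (contourFun x y) (ε : ℂ)
    (R + (Real.pi / 2 : ℝ) * Complex.I) ?_
  · have hzr : (ε : ℂ).re = ε := Complex.ofReal_re ε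
    have hzi : (ε : ℂ).im = 0 := Complex.ofReal_im ε
    have hwr : (R + (Real.pi / 2 : ℝ) * Complex.I).re = R := by simp
    have hwi : (R + (Real.pi / 2 : ℝ) * Complex.I).im = Real.pi / 2 := by simp
    rw [hzr, hzi, hwr, hwi] at h
    have him := congrArg Complex.im h
    have hb : (∫ t in ε..R, contourFun x y (t + (0 : ℝ) * Complex.I)).im = 0 := by
      have := Complex.imCLM.intervalIntegral_comp_comm
        (continuousOn_contourFun_horizontal x y hε hR le_rfl hpi).intervalIntegrable (μ := MeasureTheory.volume)
      rw [Complex.imCLM_apply] at this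
      rw [← this]
      refine (intervalIntegral.integral_congr fun t ht => ?_).trans intervalIntegral.integral_zero
      rw [Set.uIcc_of_le hR] at ht
      simpa using contourFun_ofReal_im x y (hε.trans_le ht.1)
    have ht : (∫ t in ε..R, contourFun x y (t + (Real.pi / 2 : ℝ) * Complex.I)).im =
        ∫ u in ε..R, topFun x y u := by
      have := Complex.imCLM.intervalIntegral_comp_comm
        (continuousOn_contourFun_horizontal x y hε hR hpi le_rfl).intervalIntegrable (μ := MeasureTheory.volume)
      rw [Complex.imCLM_apply] at this
      rw [← this]
      refine intervalIntegral.integral_congr fun t ht => ?_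
      rw [Set.uIcc_of_le hR] at ht
      exact contourFun_top_im x y (hε.le.trans ht.1)
    have hv : ∀ a : ℝ, 0 < a →
        (∫ t in (0 : ℝ)..Real.pi / 2, contourFun x y (a + t * Complex.I)).re =
          ∫ t in (0 : ℝ)..Real.pi / 2, (contourFun x y (a + t * Complex.I)).re := by
      intro a ha
      have := Complex.reCLM.intervalIntegral_comp_comm
        (continuousOn_contourFun_vertical x y ha).intervalIntegrable (μ := MeasureTheory.volume)
      rw [Complex.reCLM_apply] at this
      rw [← this]
      rfl
    simp only [Complex.sub_im, Complex.add_im, smul_eq_mul, Complex.I_mul_im, Complex.zero_im] at him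
    rw [hb, ht, hv R (hε.trans_le hR), hv ε hε] at him
    linarith
  · intro w hw
    rw [Complex.mem_reProdIm] at hw
    simp only [Complex.ofReal_re, Complex.ofReal_im, Complex.add_re, Complex.add_im,
      Complex.re_ofReal_mul, Complex.im_ofReal_mul, Complex.I_re, Complex.I_im, mul_zero, mul_one,
      add_zero, zero_add] at hw
    rw [Set.uIcc_of_le hR, Set.uIcc_of_le hpi] at hw
    exact (differentiableAt_contourFun x y hw.2.1 hw.2.2
      (Or.inl (hε.trans_le hw.1.1))).differentiableWithinAt

theorem coGd_le_exp {u : ℝ} (hu : 0 ≤ u) : coGd u ≤ 4 * Real.exp (-u) := by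
  have h1 := Real.mul_le_sin (coGd_pos u).le (coGd_le hu)
  have h2 : Real.sin (coGd u) = 1 / Real.cosh u := by
    rw [coGd, Real.sin_pi_div_two_sub, cos_gd]
  have h3 := one_div_cosh_le u
  have h4 : coGd u / 2 ≤ 2 / Real.pi * coGd u := by
    have : 1 / 2 ≤ 2 / Real.pi := by
      rw [div_le_div_iff₀ (by norm_num) Real.pi_pos]
      linarith [Real.pi_le_four]
    nlinarith [coGd_pos u]
  linarith

theorem abs_topFun_le {x y : ℝ} (hy : |y| < 1) {u : ℝ} (hu : 0 ≤ u) :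
    |topFun x y u| ≤ 4 * Real.exp (-(1 - x) * u) := by
  have h1 : |Real.sin (Real.pi / 2 * x + y * coGd u) - Real.sin (Real.pi / 2 * x)| ≤ coGd u := by
    refine (Real.abs_sin_sub_sin_le _ _).trans ?_
    rw [add_sub_cancel_left, abs_mul, abs_of_pos (coGd_pos u)]
    nlinarith [coGd_pos u]
  rw [topFun, abs_mul, Real.abs_exp]
  calc _ ≤ Real.exp (x * u) * (4 * Real.exp (-u)) := by
        gcongr
        exact h1.trans (coGd_le_exp hu)
    _ = 4 * (Real.exp (x * u) * Real.exp (-u)) := by ring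
    _ = _ := by rw [← Real.exp_add]; congr 2; ring

theorem integrableOn_topFun {x y : ℝ} (hx : |x| < 1) (hy : |y| < 1) :
    MeasureTheory.IntegrableOn (topFun x y) (Set.Ioi 0) :=
  integrableOn_of_abs_le_exp (continuous_topFun x y).continuousOn (c := 1 - x)
    (by linarith [(abs_lt.1 hx).2]) fun _ hu => abs_topFun_le hy (le_of_lt hu)

theorem tendsto_integral_left {x y : ℝ} (hx : |x| < 1) (hy : |y| < 1) :
    Tendsto (fun ε : ℝ => ∫ b in (0 : ℝ)..Real.pi / 2, (contourFun x y (ε + b * Complex.I)).re)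
      (𝓝[>] 0) (𝓝 (∫ b in (0 : ℝ)..Real.pi / 2, leftFun x y b)) := by
  have hpi : 0 ≤ Real.pi / 2 := by positivity
  refine intervalIntegral.tendsto_integral_filter_of_dominated_convergence
    (fun b => Real.exp 1 * ((b / 8) ^ (-|y|) + 1)) ?_ ?_ ?_ ?_
  · filter_upwards [self_mem_nhdsWithin] with ε hε
    have := (Complex.continuous_re.comp_continuousOn
      (continuousOn_contourFun_vertical x y hε)).mono Set.uIoc_subset_uIcc
    exact this.aestronglyMeasurable measurableSet_uIoc
  · have h1 : ∀ᶠ ε : ℝ in 𝓝[>] 0, ε < 1 :=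
      nhdsWithin_le_nhds (gt_mem_nhds (by norm_num : (0 : ℝ) < 1))
    filter_upwards [self_mem_nhdsWithin, h1] with ε hε hε1
    refine Eventually.of_forall fun b hb => ?_
    rw [Set.uIoc_of_le hpi] at hb
    refine (Complex.abs_re_le_norm _).trans ?_
    have hε : 0 < ε := hε
    have := norm_contourFun_le_of_re_le_one (y := y) hx (w := ε + b * Complex.I)
      (by simpa using hb.1) (by simpa using hb.2) (by simpa using hε.le) (by simpa using hε1.le)
    simpa using this
  · have h1 : IntervalIntegrable (fun b : ℝ => b ^ (-|y|) / 8 ^ (-|y|)) MeasureTheory.volume 0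
        (Real.pi / 2) :=
      (intervalIntegral.intervalIntegrable_rpow' (by linarith)).div_const _
    have h2 : IntervalIntegrable (fun b : ℝ => (b / 8) ^ (-|y|)) MeasureTheory.volume 0
        (Real.pi / 2) := by
      refine h1.congr fun b hb => ?_
      rw [Set.uIoc_of_le hpi] at hb
      exact (Real.div_rpow hb.1.le (by norm_num) _).symm
    exact (h2.add intervalIntegrable_const).const_mul _
  · refine Eventually.of_forall fun b hb => ?_
    rw [Set.uIoc_of_le hpi] at hb
    have h := (differentiableAt_contourFun x y (w := b * Complex.I) (by simpa using hb.1.le)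
      (by simpa using hb.2) (Or.inr ⟨by simp, by simpa using hb.1⟩)).continuousAt
    rw [leftFun, ← contourFun_left_re x y hb.1 hb.2]
    have h2 : Tendsto (fun ε : ℝ => (ε : ℂ) + b * Complex.I) (𝓝[>] 0) (𝓝 (b * Complex.I)) := by
      have : Continuous fun ε : ℝ => (ε : ℂ) + b * Complex.I := by fun_prop
      exact (this.tendsto' 0 _ (by simp)).mono_left nhdsWithin_le_nhds
    exact (Complex.continuous_re.tendsto _).comp (h.tendsto.comp h2)

theorem tendsto_integral_right {x y : ℝ} (hx : |x| < 1) (hy : |y| < 1) :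
    Tendsto (fun R : ℝ => ∫ b in (0 : ℝ)..Real.pi / 2, (contourFun x y (R + b * Complex.I)).re)
      atTop (𝓝 0) := by
  have hpi : 0 ≤ Real.pi / 2 := by positivity
  have h1 : Tendsto (fun R : ℝ => 6 * Real.exp (-(1 - x) * R) * |Real.pi / 2 - 0|) atTop (𝓝 0) := by
    have h2 : Tendsto (fun R : ℝ => -(1 - x) * R) atTop atBot :=
      tendsto_id.const_mul_atTop_of_neg (by linarith [(abs_lt.1 hx).2])
    have := ((Real.tendsto_exp_atBot.comp h2).const_mul 6).mul_const |Real.pi / 2 - 0|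
    simpa using this
  refine squeeze_zero_norm' ?_ h1
  filter_upwards [eventually_ge_atTop 2] with R hR
  refine intervalIntegral.norm_integral_le_of_norm_le_const fun b hb => ?_
  rw [Set.uIoc_of_le hpi] at hb
  refine (Complex.abs_re_le_norm _).trans ?_
  have := norm_contourFun_le_of_two_le (x := x) hy (w := R + b * Complex.I)
    (by simpa using hb.1.le) (by simpa using hb.2) (by simpa using hR)
  simpa using this

/-- The rectangle with ε = 1/R exhausts the half-strip as R → ∞; the right edge vanishes and the
left edge converges by domination. -/
theorem integral_topFun {x y : ℝ} (hx : |x| < 1) (hy : |y| < 1) :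
    ∫ u in Set.Ioi (0 : ℝ), topFun x y u = -∫ b in (0 : ℝ)..Real.pi / 2, leftFun x y b := by
  have h1 : Tendsto (fun R : ℝ => ∫ u in (0 : ℝ)..R, topFun x y u) atTop
      (𝓝 (∫ u in Set.Ioi (0 : ℝ), topFun x y u)) :=
    MeasureTheory.intervalIntegral_tendsto_integral_Ioi 0 (integrableOn_topFun hx hy) tendsto_id
  have hint : ∀ a b : ℝ, IntervalIntegrable (topFun x y) MeasureTheory.volume a b :=
    (continuous_topFun x y).intervalIntegrable
  have h2 : Tendsto (fun R : ℝ => ∫ u in (0 : ℝ)..R⁻¹, topFun x y u) atTop (𝓝 0) := by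
    have := (intervalIntegral.continuous_primitive hint 0).tendsto' 0 0 (by simp)
    exact this.comp tendsto_inv_atTop_zero
  have h3 := (tendsto_integral_right hx hy).sub
    ((tendsto_integral_left hx hy).comp tendsto_inv_atTop_nhdsGT_zero)
  rw [zero_sub] at h3
  rw [← sub_zero (∫ u in Set.Ioi (0 : ℝ), topFun x y u)]
  refine tendsto_nhds_unique ((h1.sub h2).congr' ?_) h3
  filter_upwards [eventually_ge_atTop 1] with R hR
  rw [intervalIntegral.integral_interval_sub_left (hint _ _) (hint _ _)]
  exact integral_topFun_eq x y (by positivity) ((inv_le_one_of_one_le₀ hR).trans hR)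

/-! ### Both edges as integrals against 1 / cosh u -/

theorem hasDerivAt_coGd (u : ℝ) : HasDerivAt coGd (-(1 / Real.cosh u)) u := by
  exact (hasDerivAt_gd u).const_sub (Real.pi / 2)

theorem tan_coGd_half (u : ℝ) : Real.tan (coGd u / 2) = Real.exp (-u) := by
  have h1 : Real.sin (coGd u) = 1 / Real.cosh u := by
    rw [coGd, Real.sin_pi_div_two_sub, cos_gd]
  have h2 : Real.cos (coGd u) = Real.sinh u / Real.cosh u := by
    rw [coGd, Real.cos_pi_div_two_sub, sin_gd]
  have hc := Real.cosh_pos u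
  have h3 : Real.sin (coGd u) = 2 * Real.sin (coGd u / 2) * Real.cos (coGd u / 2) := by
    rw [← Real.sin_two_mul]; congr 1; ring
  have h4 : Real.cos (coGd u) = 1 - 2 * Real.sin (coGd u / 2) ^ 2 := by
    have := Real.cos_two_mul (coGd u / 2)
    rw [mul_div_cancel₀ _ two_ne_zero] at this
    linarith [Real.sin_sq_add_cos_sq (coGd u / 2)]
  have hs : Real.sin (coGd u / 2) ≠ 0 := by
    intro h
    rw [h, mul_zero, zero_mul, h1] at h3
    exact (one_div_pos.2 hc).ne' h3
  have hc2 : Real.cos (coGd u / 2) ≠ 0 := by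
    intro h
    rw [h, mul_zero, h1] at h3
    exact (one_div_pos.2 hc).ne' h3
  rw [h1] at h3
  rw [h2] at h4
  rw [Real.tan_eq_sin_div_cos, div_eq_iff hc2, ← Real.cosh_sub_sinh]
  field_simp at h3 h4
  refine mul_left_cancel₀ (mul_ne_zero two_ne_zero hs) ?_
  linear_combination 2 * Real.sin (coGd u / 2) ^ 2 * h3 +
    2 * Real.sin (coGd u / 2) * Real.cos (coGd u / 2) * h4

theorem tendsto_coGd_atTop : Tendsto coGd atTop (𝓝 0) := by
  have h : Tendsto (fun u : ℝ => 4 * Real.exp (-u)) atTop (𝓝 0) := by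
    simpa using (Real.tendsto_exp_neg_atTop_nhds_zero).const_mul 4
  refine squeeze_zero' (Eventually.of_forall fun u => (coGd_pos u).le) ?_ h
  filter_upwards [eventually_ge_atTop 0] with u hu using coGd_le_exp hu

theorem coGd_zero : coGd 0 = Real.pi / 2 := by simp [coGd, gd_zero]

theorem strictAnti_coGd : StrictAnti coGd := fun _ _ h =>
  sub_lt_sub_left (Real.arctan_strictMono (Real.sinh_strictMono h)) _

theorem image_coGd : coGd '' Set.Ioi 0 = Set.Ioo 0 (Real.pi / 2) := by
  ext b
  constructor
  · rintro ⟨u, hu, rfl⟩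
    exact ⟨coGd_pos u, coGd_zero ▸ strictAnti_coGd hu⟩
  · rintro ⟨h0, h1⟩
    refine ⟨Real.arsinh (Real.tan (Real.pi / 2 - b)), ?_, ?_⟩
    · rw [Set.mem_Ioi, Real.arsinh_pos_iff]
      exact Real.tan_pos_of_pos_of_lt_pi_div_two (by linarith) (by linarith)
    · rw [coGd, gd, Real.sinh_arsinh, Real.arctan_tan (by linarith) (by linarith)]
      ring

theorem abs_div_cosh_le (f u : ℝ) : |f / Real.cosh u| ≤ 2 * (|f| * Real.exp (-u)) := by
  rw [abs_div, abs_of_pos (Real.cosh_pos u), div_eq_mul_one_div]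
  have := one_div_cosh_le u
  have := mul_le_mul_of_nonneg_left this (abs_nonneg f)
  linarith

theorem integrableOn_exp_mul_div_cosh {x : ℝ} (hx : x < 1) {f : ℝ → ℝ} (hf : Continuous f)
    (h : ∀ u, |f u| ≤ 1) :
    MeasureTheory.IntegrableOn (fun u => Real.exp (x * u) * f u / Real.cosh u) (Set.Ioi 0) := by
  refine integrableOn_of_abs_le_exp (C := 2) (c := 1 - x) ?_ (by linarith) fun u _ => ?_
  · have h2 : ∀ u, Real.cosh u ≠ 0 := fun u => (Real.cosh_pos u).ne'
    exact Continuous.continuousOn (by fun_prop (disch := exact h2))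
  · refine (abs_div_cosh_le _ u).trans ?_
    rw [abs_mul, Real.abs_exp]
    calc 2 * (Real.exp (x * u) * |f u| * Real.exp (-u))
        ≤ 2 * (Real.exp (x * u) * 1 * Real.exp (-u)) := by
          gcongr
          exact h u
      _ = _ := by rw [mul_one, ← Real.exp_add]; congr 2; ring

/-- The substitution b = `coGd u`, with tan(b/2) = exp(-u) and |db| = du / cosh u. The factor x
makes the term without a power of tan the exact derivative of -sin(x `coGd u`). -/
theorem integral_leftFun {x y : ℝ} (hy : |y| < 1) :
    x * ∫ b in (0 : ℝ)..Real.pi / 2, leftFun x y b =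
      x * (∫ u in Set.Ioi (0 : ℝ), Real.exp (-y * u) *
        Real.cos (x * coGd u + Real.pi / 2 * y) / Real.cosh u) - Real.sin (Real.pi / 2 * x) := by
  have hpi : 0 ≤ Real.pi / 2 := by positivity
  have hc := continuous_coGd
  rw [intervalIntegral.integral_of_le hpi, MeasureTheory.integral_Ioc_eq_integral_Ioo, ← image_coGd,
    MeasureTheory.integral_image_eq_integral_abs_deriv_smul measurableSet_Ioi
      (fun u _ => (hasDerivAt_coGd u).hasDerivWithinAt) strictAnti_coGd.injective.injOn]
  have i1 := integrableOn_exp_mul_div_cosh (x := -y) (by linarith [(abs_lt.1 hy).1])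
    (f := fun u => Real.cos (x * coGd u + Real.pi / 2 * y)) (by fun_prop)
    (fun u => Real.abs_cos_le_one _)
  have i2 := integrableOn_exp_mul_div_cosh (x := 0) (by norm_num)
    (f := fun u => Real.cos (x * coGd u)) (by fun_prop) (fun u => Real.abs_cos_le_one _)
  have e : ∀ u ∈ Set.Ioi (0 : ℝ), |-(1 / Real.cosh u)| • leftFun x y (coGd u) =
      Real.exp (-y * u) * Real.cos (x * coGd u + Real.pi / 2 * y) / Real.cosh u -
        Real.exp (0 * u) * Real.cos (x * coGd u) / Real.cosh u := by
    intro u _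
    have hcosh := Real.cosh_pos u
    rw [abs_neg, abs_of_pos (by positivity), leftFun, tan_coGd_half, ← Real.exp_mul, smul_eq_mul,
      zero_mul, Real.exp_zero, show -u * y = -y * u by ring]
    ring
  rw [MeasureTheory.setIntegral_congr_fun measurableSet_Ioi e,
    MeasureTheory.integral_sub i1 i2, mul_sub]
  congr 1
  have h := MeasureTheory.integral_Ioi_of_hasDerivAt_of_tendsto' (a := 0)
    (f := fun u => -Real.sin (x * coGd u)) (m := -Real.sin (x * 0))
    (f' := fun u => x * (Real.exp (0 * u) * Real.cos (x * coGd u) / Real.cosh u)) ?_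
    (i2.const_mul x) ?_
  · rw [MeasureTheory.integral_const_mul] at h
    rw [h, coGd_zero]
    simp [mul_comm]
  · intro u _
    refine (((hasDerivAt_coGd u).const_mul x).sin.neg).congr_deriv ?_
    rw [zero_mul, Real.exp_zero]
    ring
  · exact ((Real.continuous_sin.tendsto _).comp (tendsto_coGd_atTop.const_mul x)).neg

/-- The derivative of `topFun` is x `topFun` minus y times the integrand on the right, so its
boundary value at 0 links the two integrals. -/
theorem integral_topFun_by_parts {x y : ℝ} (hx : |x| < 1) (hy : |y| < 1) :
    x * ∫ u in Set.Ioi (0 : ℝ), topFun x y u =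
      y * (∫ u in Set.Ioi (0 : ℝ), Real.exp (x * u) *
        Real.cos (Real.pi / 2 * x + y * coGd u) / Real.cosh u) -
        Real.sin (Real.pi / 2 * x + y * (Real.pi / 2)) + Real.sin (Real.pi / 2 * x) := by
  have hc := continuous_coGd
  have i1 := integrableOn_exp_mul_div_cosh (x := x) (abs_lt.1 hx).2
    (f := fun u => Real.cos (Real.pi / 2 * x + y * coGd u)) (by fun_prop)
    (fun u => Real.abs_cos_le_one _)
  have h := MeasureTheory.integral_Ioi_of_hasDerivAt_of_tendsto' (a := 0) (f := topFun x y) (m := 0)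
    (f' := fun u => x * topFun x y u - y * (Real.exp (x * u) *
      Real.cos (Real.pi / 2 * x + y * coGd u) / Real.cosh u)) ?_
    (((integrableOn_topFun hx hy).const_mul x).sub (i1.const_mul y)) ?_
  · rw [MeasureTheory.integral_sub ((integrableOn_topFun hx hy).const_mul x) (i1.const_mul y),
      MeasureTheory.integral_const_mul, MeasureTheory.integral_const_mul] at h
    simp only [topFun] at h ⊢
    rw [coGd_zero, mul_zero, Real.exp_zero] at h
    linarith
  · intro u _
    unfold topFun
    refine ((((hasDerivAt_id u).const_mul x).exp).mul
      ((((hasDerivAt_coGd u).const_mul y).const_add (Real.pi / 2 * x)).sin.sub_const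
        (Real.sin (Real.pi / 2 * x)))).congr_deriv ?_
    simp only [id]
    ring
  · have h1 : Tendsto (fun u : ℝ => 4 * Real.exp (-(1 - x) * u)) atTop (𝓝 0) := by
      have h2 : Tendsto (fun u : ℝ => -(1 - x) * u) atTop atBot :=
        tendsto_id.const_mul_atTop_of_neg (by linarith [(abs_lt.1 hx).2])
      simpa using (Real.tendsto_exp_atBot.comp h2).const_mul 4
    refine squeeze_zero_norm' ?_ h1
    filter_upwards [eventually_ge_atTop 0] with u hu using abs_topFun_le hy hu

/-! ### The duality of the generating function -/

/-- `∫ exp (x u) cos (y gd u) / cosh u` over the positive half-line. -/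
def cosIntegral (x y : ℝ) : ℝ :=
  ∫ u in Set.Ioi (0 : ℝ), Real.exp (x * u) * Real.cos (y * gd u) / Real.cosh u

/-- `∫ exp (x u) sin (y gd u) / cosh u` over the positive half-line. -/
def sinIntegral (x y : ℝ) : ℝ :=
  ∫ u in Set.Ioi (0 : ℝ), Real.exp (x * u) * Real.sin (y * gd u) / Real.cosh u

theorem integral_cos_sub {x : ℝ} (hx : |x| < 1) (y d : ℝ) :
    ∫ u in Set.Ioi (0 : ℝ), Real.exp (x * u) * Real.cos (d - y * gd u) / Real.cosh u =
      Real.cos d * cosIntegral x y + Real.sin d * sinIntegral x y := by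
  have hg := continuous_gd
  have i1 := integrableOn_exp_mul_div_cosh (x := x) (abs_lt.1 hx).2
    (f := fun u => Real.cos (y * gd u)) (by fun_prop) (fun u => Real.abs_cos_le_one _)
  have i2 := integrableOn_exp_mul_div_cosh (x := x) (abs_lt.1 hx).2
    (f := fun u => Real.sin (y * gd u)) (by fun_prop) (fun u => Real.abs_sin_le_one _)
  rw [cosIntegral, sinIntegral, ← MeasureTheory.integral_const_mul,
    ← MeasureTheory.integral_const_mul,
    ← MeasureTheory.integral_add (i1.const_mul _) (i2.const_mul _)]
  refine MeasureTheory.integral_congr_ae (Eventually.of_forall fun u => ?_)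
  simp only [Real.cos_sub]
  ring

theorem cosIntegral_neg (x y : ℝ) : cosIntegral x (-y) = cosIntegral x y := by
  simp [cosIntegral]

theorem sinIntegral_neg (x y : ℝ) : sinIntegral x (-y) = -sinIntegral x y := by
  rw [sinIntegral, sinIntegral, ← MeasureTheory.integral_neg]
  refine MeasureTheory.integral_congr_ae (Eventually.of_forall fun u => ?_)
  simp only [neg_mul, Real.sin_neg]
  ring

/-- Cauchy's theorem with both edges rewritten: the top edge supplies the integrals at (x, y), the
left edge those at (-y, x), and the two sin(πx/2) terms cancel. -/
theorem cosIntegral_sinIntegral_relation {x y : ℝ} (hx : |x| < 1) (hy : |y| < 1) :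
    y * (Real.cos (Real.pi / 2 * (x + y)) * cosIntegral x y +
        Real.sin (Real.pi / 2 * (x + y)) * sinIntegral x y) +
      x * (Real.cos (Real.pi / 2 * (x + y)) * cosIntegral (-y) x +
        Real.sin (Real.pi / 2 * (x + y)) * sinIntegral (-y) x) =
      Real.sin (Real.pi / 2 * (x + y)) := by
  have h1 := integral_topFun_by_parts hx hy
  have h2 := integral_leftFun (x := x) hy
  rw [integral_topFun hx hy, mul_neg, h2] at h1
  rw [← integral_cos_sub hx, ← integral_cos_sub (by rwa [abs_neg])]
  have e1 : ∀ u, Real.pi / 2 * (x + y) - y * gd u = Real.pi / 2 * x + y * coGd u := by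
    intro u; rw [coGd]; ring
  have e2 : ∀ u, Real.pi / 2 * (x + y) - x * gd u = x * coGd u + Real.pi / 2 * y := by
    intro u; rw [coGd]; ring
  simp only [e1, e2]
  rw [show Real.pi / 2 * (x + y) = Real.pi / 2 * x + y * (Real.pi / 2) by ring]
  linarith

/-- `∫ cosh (x u) cos (y gd u) / cosh u` over the positive half-line. -/
def coshCosIntegral (x y : ℝ) : ℝ :=
  ∫ u in Set.Ioi (0 : ℝ), Real.cosh (x * u) * Real.cos (y * gd u) / Real.cosh u

theorem two_mul_coshCosIntegral {x : ℝ} (hx : |x| < 1) (y : ℝ) :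
    2 * coshCosIntegral x y = cosIntegral x y + cosIntegral (-x) y := by
  have hg := continuous_gd
  have i1 := integrableOn_exp_mul_div_cosh (x := x) (abs_lt.1 hx).2
    (f := fun u => Real.cos (y * gd u)) (by fun_prop) (fun u => Real.abs_cos_le_one _)
  have i2 := integrableOn_exp_mul_div_cosh (x := -x) (by linarith [(abs_lt.1 hx).1])
    (f := fun u => Real.cos (y * gd u)) (by fun_prop) (fun u => Real.abs_cos_le_one _)
  rw [cosIntegral, cosIntegral, coshCosIntegral, ← MeasureTheory.integral_add i1 i2,
    ← MeasureTheory.integral_const_mul]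
  refine MeasureTheory.integral_congr_ae (Eventually.of_forall fun u => ?_)
  simp only [Real.cosh_eq (x * u), neg_mul]
  ring

theorem coshCosIntegral_duality {x y : ℝ} (hx : |x| < 1) (hy : |y| < 1) :
    y * Real.sin (Real.pi * x) * coshCosIntegral x y =
      x * Real.sin (Real.pi * y) * coshCosIntegral y x := by
  have hx' : |-x| < 1 := by rwa [abs_neg]
  have hy' : |-y| < 1 := by rwa [abs_neg]
  have r1 := cosIntegral_sinIntegral_relation hx hy
  have r2 := cosIntegral_sinIntegral_relation hx' hy'
  have r3 := cosIntegral_sinIntegral_relation hx hy'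
  have r4 := cosIntegral_sinIntegral_relation hx' hy
  have j1 := two_mul_coshCosIntegral hx y
  have j2 := two_mul_coshCosIntegral hy x
  rw [show Real.pi / 2 * (-x + -y) = -(Real.pi / 2 * (x + y)) by ring] at r2
  rw [show Real.pi / 2 * (x + -y) = Real.pi / 2 * (x - y) by ring] at r3
  rw [show Real.pi / 2 * (-x + y) = -(Real.pi / 2 * (x - y)) by ring] at r4
  simp only [cosIntegral_neg, sinIntegral_neg, neg_neg, Real.cos_neg, Real.sin_neg] at r1 r2 r3 r4
  have s1 : Real.sin (Real.pi * x) =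
      Real.sin (Real.pi / 2 * (x + y)) * Real.cos (Real.pi / 2 * (x - y)) +
        Real.cos (Real.pi / 2 * (x + y)) * Real.sin (Real.pi / 2 * (x - y)) := by
    rw [← Real.sin_add]; congr 1; ring
  have s2 : Real.sin (Real.pi * y) =
      Real.sin (Real.pi / 2 * (x + y)) * Real.cos (Real.pi / 2 * (x - y)) -
        Real.cos (Real.pi / 2 * (x + y)) * Real.sin (Real.pi / 2 * (x - y)) := by
    rw [← Real.sin_sub]; congr 1; ring
  rw [s1, s2]
  set A := Real.sin (Real.pi / 2 * (x + y))
  set B := Real.cos (Real.pi / 2 * (x + y))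
  set C := Real.sin (Real.pi / 2 * (x - y))
  set D := Real.cos (Real.pi / 2 * (x - y))
  -- r1 - r2 and r3 - r4 contain the same symmetrised sine integrals and constants, weighted by A
  -- and by C respectively; multiplying by C and by A and subtracting eliminates both.
  linear_combination (y * (A * D + B * C) / 2) * j1 - (x * (A * D - B * C) / 2) * j2 +
    C / 2 * (r1 - r2) - A / 2 * (r3 - r4)

/-! ### Comparison of power series coefficients -/

/-- The value t = 0 is not available, so c 0 is bounded by t times a constant obtained at t = 1/2,
and t tends to 0. -/
theorem coeff_zero_of_hasSum_zero {c : ℕ → ℝ}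
    (h : ∀ t : ℝ, 0 < t → t < 1 → HasSum (fun n => c n * t ^ n) 0) : c 0 = 0 := by
  have hs : Summable fun n => |c (n + 1) * (1 / 2) ^ n| := by
    have := (summable_nat_add_iff 1).2 (h (1 / 2) (by norm_num) (by norm_num)).summable
    refine (this.mul_left 2).abs.congr fun n => ?_
    rw [pow_succ]
    congr 1
    ring
  set K := ∑' n, |c (n + 1) * (1 / 2) ^ n|
  have hK : 0 ≤ K := tsum_nonneg fun n => abs_nonneg _
  have key : ∀ t : ℝ, 0 < t → t ≤ 1 / 2 → |c 0| ≤ t * K := by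
    intro t ht ht'
    have h1 := (hasSum_nat_add_iff' 1).2 (h t ht (by linarith))
    simp only [Finset.range_one, Finset.sum_singleton, pow_zero, mul_one, zero_sub] at h1
    rw [← abs_neg, ← h1.tsum_eq, ← Real.norm_eq_abs]
    refine tsum_of_norm_bounded (hs.hasSum.mul_left t) fun n => ?_
    rw [Real.norm_eq_abs, pow_succ, ← mul_assoc, abs_mul, abs_of_pos ht, mul_comm, abs_mul, abs_mul,
      abs_of_pos (pow_pos ht n), abs_of_pos (by positivity : (0 : ℝ) < (1 / 2) ^ n)]
    gcongr
  by_contra hc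
  have hpos : 0 < |c 0| := abs_pos.2 hc
  have hK1 : 0 < K + 1 := by linarith
  have h1 := key (min (1 / 2) (|c 0| / (2 * (K + 1)))) (by positivity) (min_le_left _ _)
  have h2 : min (1 / 2) (|c 0| / (2 * (K + 1))) * K ≤ |c 0| / (2 * (K + 1)) * (K + 1) :=
    mul_le_mul (min_le_right _ _) (by linarith) hK (by positivity)
  have h3 : |c 0| / (2 * (K + 1)) * (K + 1) = |c 0| / 2 := by field_simp
  linarith

theorem coeff_eq_zero_of_hasSum_zero {c : ℕ → ℝ}
    (h : ∀ t : ℝ, 0 < t → t < 1 → HasSum (fun n => c n * t ^ n) 0) (n : ℕ) : c n = 0 := by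
  induction n generalizing c with
  | zero => exact coeff_zero_of_hasSum_zero h
  | succ n ih =>
    refine ih (c := fun n => c (n + 1)) fun t ht ht' => ?_
    have h1 := (hasSum_nat_add_iff' 1).2 (h t ht ht')
    simp only [Finset.range_one, Finset.sum_singleton, coeff_zero_of_hasSum_zero h, zero_mul,
      sub_zero] at h1
    have h2 := h1.div_const t
    rw [zero_div] at h2
    refine h2.congr_fun fun n => ?_
    rw [pow_succ]
    field_simp

theorem coeff_eq_of_hasSum {a b : ℕ → ℝ} {f : ℝ → ℝ}
    (ha : ∀ t : ℝ, 0 < t → t < 1 → HasSum (fun n => a n * t ^ n) (f t))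
    (hb : ∀ t : ℝ, 0 < t → t < 1 → HasSum (fun n => b n * t ^ n) (f t)) (n : ℕ) : a n = b n := by
  refine sub_eq_zero.1 (coeff_eq_zero_of_hasSum_zero (c := fun n => a n - b n)
    (fun t ht ht' => ?_) n)
  have := (ha t ht ht').sub (hb t ht ht')
  rw [sub_self] at this
  exact this.congr_fun fun n => by ring

theorem hasSum_pow_mul {p q : ℕ → ℝ} {t a b : ℝ} (hp : HasSum (fun n => p n * t ^ n) a)
    (hq : HasSum (fun n => q n * t ^ n) b) :
    HasSum (fun n => (∑ x ∈ Finset.HasAntidiagonal.antidiagonal n, p x.1 * q x.2) * t ^ n)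
      (a * b) := by
  have h1 := hp.summable.norm
  have h2 := hq.summable.norm
  have h3 := (summable_norm_sum_mul_antidiagonal_of_summable_norm h1 h2).of_norm.hasSum
  rw [← tsum_mul_tsum_eq_tsum_sum_antidiagonal_of_summable_norm h1 h2, hp.tsum_eq, hq.tsum_eq] at h3
  refine h3.congr_fun fun n => ?_
  rw [Finset.sum_mul]
  refine Finset.sum_congr rfl fun x hx => ?_
  rw [Finset.HasAntidiagonal.mem_antidiagonal] at hx
  rw [← hx, pow_add]
  ring

/-! ### Double power series of the generating function -/

/-- The term of the double expansion of the integrand of `coshCosIntegral x y`. -/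
def doubleTerm (x y : ℝ) (i : ℕ × ℕ) (u : ℝ) : ℝ :=
  ((x * u) ^ (2 * i.1) / (2 * i.1).factorial) *
    ((-1) ^ i.2 * (y * gd u) ^ (2 * i.2) / (2 * i.2).factorial) * (1 / Real.cosh u)

theorem abs_doubleTerm (x y : ℝ) (i : ℕ × ℕ) (u : ℝ) : |doubleTerm x y i u| =
    ((x * u) ^ (2 * i.1) / (2 * i.1).factorial) *
      ((y * gd u) ^ (2 * i.2) / (2 * i.2).factorial) * (1 / Real.cosh u) := by
  have h1 : 0 ≤ (x * u) ^ (2 * i.1) := (even_two_mul _).pow_nonneg _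
  have h2 : 0 ≤ (y * gd u) ^ (2 * i.2) := (even_two_mul _).pow_nonneg _
  have h3 := Real.cosh_pos u
  rw [doubleTerm, abs_mul, abs_mul, abs_div, abs_div, abs_mul, abs_pow (-1 : ℝ), abs_neg, abs_one, one_pow,
    one_mul, abs_of_nonneg h1, abs_of_nonneg h2, Nat.abs_cast, Nat.abs_cast,
    abs_of_pos (one_div_pos.2 h3)]

theorem doubleTerm_eq (x y : ℝ) (i : ℕ × ℕ) (u : ℝ) : doubleTerm x y i u =
    (x ^ (2 * i.1) * ((-1) ^ i.2 * y ^ (2 * i.2))) *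
      (gd u ^ (2 * i.2) / (2 * i.2).factorial * (u ^ (2 * i.1) / (2 * i.1).factorial) *
        (1 / Real.cosh u)) := by
  rw [doubleTerm, mul_pow, mul_pow]
  ring

theorem integrableOn_doubleTerm (x y : ℝ) (i : ℕ × ℕ) :
    MeasureTheory.IntegrableOn (doubleTerm x y i) (Set.Ioi 0) := by
  refine ((integrableOn_gdPow_mul_argPow (2 * i.2) (2 * i.1)).const_mul
    (x ^ (2 * i.1) * ((-1) ^ i.2 * y ^ (2 * i.2)))).congr (Eventually.of_forall fun u => ?_)
  simp only [doubleTerm_eq, gdPow, argPow, (even_two_mul i.2).neg_pow]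
  ring

theorem integrableOn_cosh_mul_cosh {x y : ℝ} (hx : |x| < 1) (hy : |y| < 1) :
    MeasureTheory.IntegrableOn
      (fun u => Real.cosh (x * u) * Real.cosh (y * gd u) * (1 / Real.cosh u)) (Set.Ioi 0) := by
  have hg := continuous_gd
  have hf : ∀ u, |Real.cosh (y * gd u) / Real.cosh 2| ≤ 1 := by
    intro u
    have h2 := Real.cosh_pos 2
    -- The bounds |gd| ≤ 2 and |y| < 1 give cosh(y gd u) ≤ cosh 2, hence the normalisation.
    rw [abs_of_pos (div_pos (Real.cosh_pos _) h2), div_le_one h2, Real.cosh_le_cosh, abs_mul]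
    have := abs_gd_le u
    rw [abs_of_pos (by norm_num : (0 : ℝ) < 2)]
    nlinarith [abs_nonneg (gd u), abs_nonneg y]
  have i1 := integrableOn_exp_mul_div_cosh (x := x) (abs_lt.1 hx).2
    (f := fun u => Real.cosh (y * gd u) / Real.cosh 2) (by fun_prop) hf
  have i2 := integrableOn_exp_mul_div_cosh (x := -x) (by linarith [(abs_lt.1 hx).1])
    (f := fun u => Real.cosh (y * gd u) / Real.cosh 2) (by fun_prop) hf
  refine ((i1.add i2).const_mul (Real.cosh 2 / 2)).congr (Eventually.of_forall fun u => ?_)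
  have h2 := Real.cosh_pos 2
  simp only [Pi.add_apply, Real.cosh_eq (x * u), neg_mul]
  field_simp

theorem hasSum_abs_doubleTerm (x y u : ℝ) : HasSum (fun i => |doubleTerm x y i u|)
    (Real.cosh (x * u) * Real.cosh (y * gd u) * (1 / Real.cosh u)) := by
  simp only [abs_doubleTerm]
  have h1 := Real.hasSum_cosh (x * u)
  have h2 := Real.hasSum_cosh (y * gd u)
  exact (h1.mul h2 (h1.summable.mul_of_nonneg h2.summable
    (fun n => div_nonneg ((even_two_mul _).pow_nonneg _) (Nat.cast_nonneg _))
    (fun n => div_nonneg ((even_two_mul _).pow_nonneg _) (Nat.cast_nonneg _)))).mul_right _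

theorem hasSum_doubleTerm (x y u : ℝ) : HasSum (fun i => doubleTerm x y i u)
    (Real.cosh (x * u) * Real.cos (y * gd u) / Real.cosh u) := by
  rw [div_eq_mul_one_div]
  have h1 := Real.hasSum_cosh (x * u)
  have h2 := Real.hasSum_cos (y * gd u)
  exact (h1.mul h2 (summable_mul_of_summable_norm h1.summable.norm h2.summable.norm)).mul_right _

/-- Replacing cos by cosh makes every term nonnegative and leaves the integrand integrable; this
bounds the sum of the L¹ norms and allows termwise integration. -/
theorem hasSum_coshCosIntegral {x y : ℝ} (hx : |x| < 1) (hy : |y| < 1) :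
    HasSum (fun i : ℕ × ℕ => x ^ (2 * i.1) * ((-1) ^ i.2 * y ^ (2 * i.2)) *
      gdIntegral (2 * i.2) (2 * i.1)) (coshCosIntegral x y) := by
  have hsum : Summable fun i : ℕ × ℕ => ∫ u in Set.Ioi (0 : ℝ), ‖doubleTerm x y i u‖ := by
    refine summable_of_sum_le (fun i => MeasureTheory.integral_nonneg fun u => norm_nonneg _)
      (c := ∫ u in Set.Ioi (0 : ℝ), Real.cosh (x * u) * Real.cosh (y * gd u) * (1 / Real.cosh u))
      fun s => ?_
    rw [← MeasureTheory.integral_finsetSum _ fun i _ => (integrableOn_doubleTerm x y i).norm]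
    refine MeasureTheory.integral_mono
      (MeasureTheory.integrable_finsetSum _ fun i _ => (integrableOn_doubleTerm x y i).norm)
      (integrableOn_cosh_mul_cosh hx hy) fun u => ?_
    exact sum_le_hasSum _ (fun i _ => norm_nonneg _) (hasSum_abs_doubleTerm x y u)
  have h := MeasureTheory.hasSum_integral_of_summable_integral_norm
    (fun i => integrableOn_doubleTerm x y i) hsum
  have e : ∫ u in Set.Ioi (0 : ℝ), ∑' i, doubleTerm x y i u = coshCosIntegral x y :=
    MeasureTheory.integral_congr_ae (Eventually.of_forall fun u => (hasSum_doubleTerm x y u).tsum_eq)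
  rw [e] at h
  refine h.congr_fun fun i => ?_
  rw [gdIntegral, ← MeasureTheory.integral_const_mul]
  exact MeasureTheory.integral_congr_ae (Eventually.of_forall fun u => (doubleTerm_eq x y i u).symm)

/-- The coefficient of `x ^ (2 b)` in `coshCosIntegral x y`. -/
def cosCoeff (b : ℕ) (y : ℝ) : ℝ :=
  ∑' a : ℕ, (-1) ^ a * gdIntegral (2 * a) (2 * b) * (y ^ 2) ^ a

/-- The coefficient of `(-1) ^ a * y ^ (2 a)` in `coshCosIntegral x y`. -/
def coshCoeff (a : ℕ) (x : ℝ) : ℝ :=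
  ∑' b : ℕ, gdIntegral (2 * a) (2 * b) * (x ^ 2) ^ b

/-- A row of the summable double series at x = 1/2, rescaled by 2^(2b) to remove the power of x. -/
theorem hasSum_cosCoeff (b : ℕ) {y : ℝ} (hy : |y| < 1) :
    HasSum (fun a : ℕ => (-1) ^ a * gdIntegral (2 * a) (2 * b) * (y ^ 2) ^ a) (cosCoeff b y) := by
  have h := ((hasSum_coshCosIntegral (x := 1 / 2) (by norm_num [abs_of_pos]) hy).summable.prod_factor
    b).mul_left (2 ^ (2 * b))
  refine (h.congr fun a => ?_).hasSum
  have : (2 : ℝ) ^ (2 * b) * (1 / 2) ^ (2 * b) = 1 := by rw [← mul_pow]; norm_num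
  rw [pow_mul y]
  linear_combination ((-1) ^ a * gdIntegral (2 * a) (2 * b) * (y ^ 2) ^ a) * this

theorem hasSum_coshCoeff (a : ℕ) {x : ℝ} (hx : |x| < 1) :
    HasSum (fun b : ℕ => gdIntegral (2 * a) (2 * b) * (x ^ 2) ^ b) (coshCoeff a x) := by
  have h := ((hasSum_coshCosIntegral (y := 1 / 2) hx
    (by norm_num [abs_of_pos])).summable.prod_symm.prod_factor a).mul_left ((-1) ^ a * 2 ^ (2 * a))
  refine (h.congr fun b => ?_).hasSum
  have h1 : (2 : ℝ) ^ (2 * a) * (1 / 2) ^ (2 * a) = 1 := by rw [← mul_pow]; norm_num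
  have h2 : ((-1 : ℝ) ^ a) * (-1) ^ a = 1 := by rw [← mul_pow]; norm_num
  simp only [Prod.swap]
  rw [pow_mul x]
  linear_combination (gdIntegral (2 * a) (2 * b) * (x ^ 2) ^ b) * h1 +
    (gdIntegral (2 * a) (2 * b) * (x ^ 2) ^ b) * (2 ^ (2 * a) * (1 / 2) ^ (2 * a)) * h2

theorem hasSum_pow_mul_cosCoeff {x y : ℝ} (hx : |x| < 1) (hy : |y| < 1) :
    HasSum (fun b : ℕ => cosCoeff b y * (x ^ 2) ^ b) (coshCosIntegral x y) := by
  refine (hasSum_coshCosIntegral hx hy).prod_fiberwise fun b => ?_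
  refine ((hasSum_cosCoeff b hy).mul_right ((x ^ 2) ^ b)).congr_fun fun a => ?_
  simp only [pow_mul]
  ring

theorem hasSum_pow_mul_coshCoeff {x y : ℝ} (hx : |x| < 1) (hy : |y| < 1) :
    HasSum (fun a : ℕ => (-1) ^ a * coshCoeff a x * (y ^ 2) ^ a) (coshCosIntegral x y) := by
  refine ((Equiv.prodComm ℕ ℕ).hasSum_iff.2 (hasSum_coshCosIntegral hx hy)).prod_fiberwise
    fun a => ?_
  rw [mul_right_comm]
  refine ((hasSum_coshCoeff a hx).mul_left ((-1) ^ a * (y ^ 2) ^ a)).congr_fun fun b => ?_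
  simp only [Function.comp, Equiv.prodComm_apply, Prod.swap, pow_mul]
  ring

theorem hasSum_sincCoeff {x : ℝ} (hx : x ≠ 0) :
    HasSum (fun n => sincCoeff n * (x ^ 2) ^ n) (Real.sin (Real.pi * x) / (Real.pi * x)) := by
  refine ((Real.hasSum_sin (Real.pi * x)).div_const (Real.pi * x)).congr_fun fun n => ?_
  have := Real.pi_ne_zero
  rw [sincCoeff, mul_pow, ← pow_mul, pow_succ, pow_succ]
  field_simp

/-- The coefficient of x^(2n) in the duality divided by πxy, with y fixed and t = x² as the
variable. -/
theorem sum_sincCoeff_mul_cosCoeff (n : ℕ) {y : ℝ} (hy0 : 0 < y) (hy1 : y < 1) :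
    ∑ x ∈ Finset.HasAntidiagonal.antidiagonal n, sincCoeff x.1 * cosCoeff x.2 y =
      Real.sin (Real.pi * y) / (Real.pi * y) * ((-1) ^ n * coshCoeff n y) := by
  have hy : |y| < 1 := by rwa [abs_of_pos hy0]
  refine coeff_eq_of_hasSum (a := fun n => ∑ x ∈ Finset.HasAntidiagonal.antidiagonal n,
      sincCoeff x.1 * cosCoeff x.2 y)
    (b := fun n => Real.sin (Real.pi * y) / (Real.pi * y) * ((-1) ^ n * coshCoeff n y))
    (f := fun t => Real.sin (Real.pi * √t) / (Real.pi * √t) * coshCosIntegral √t y)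
    (fun t ht ht1 => ?_) (fun t ht ht1 => ?_) n
  all_goals
    have hs : 0 < √t := Real.sqrt_pos.2 ht
    have hs1 : |√t| < 1 := by
      rw [abs_of_pos hs, Real.sqrt_lt' one_pos]
      linarith
    have hsq : √t ^ 2 = t := Real.sq_sqrt ht.le
  · have h1 := hasSum_sincCoeff hs.ne'
    have h2 := hasSum_pow_mul_cosCoeff hs1 hy
    rw [hsq] at h1 h2
    exact hasSum_pow_mul (p := sincCoeff) (q := fun n => cosCoeff n y) h1 h2
  · have h2 := hasSum_pow_mul_coshCoeff hy hs1
    rw [hsq] at h2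
    have e : Real.sin (Real.pi * √t) / (Real.pi * √t) * coshCosIntegral √t y =
        Real.sin (Real.pi * y) / (Real.pi * y) * coshCosIntegral y √t := by
      have := coshCosIntegral_duality hs1 hy
      have hpi := Real.pi_ne_zero
      field_simp
      linear_combination this
    simp only [e]
    refine (h2.mul_left (Real.sin (Real.pi * y) / (Real.pi * y))).congr_fun fun n => ?_
    ring

/-- The coefficient of y^(2m) in the preceding identity: comparing both variables leaves a relation
between the moments alone. -/
theorem sum_sincCoeff_mul_gdIntegral (m n : ℕ) :
    ∑ x ∈ Finset.HasAntidiagonal.antidiagonal n,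
        sincCoeff x.1 * ((-1) ^ m * gdIntegral (2 * m) (2 * x.2)) =
      (-1) ^ n * ∑ x ∈ Finset.HasAntidiagonal.antidiagonal m,
        sincCoeff x.1 * gdIntegral (2 * n) (2 * x.2) := by
  refine coeff_eq_of_hasSum (a := fun m => ∑ x ∈ Finset.HasAntidiagonal.antidiagonal n,
        sincCoeff x.1 * ((-1) ^ m * gdIntegral (2 * m) (2 * x.2)))
    (b := fun m => (-1) ^ n * ∑ x ∈ Finset.HasAntidiagonal.antidiagonal m,
        sincCoeff x.1 * gdIntegral (2 * n) (2 * x.2))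
    (f := fun t => ∑ x ∈ Finset.HasAntidiagonal.antidiagonal n, sincCoeff x.1 * cosCoeff x.2 √t)
    (fun t ht ht1 => ?_) (fun t ht ht1 => ?_) m
  all_goals
    have hs : 0 < √t := Real.sqrt_pos.2 ht
    have hs1 : √t < 1 := by
      rw [Real.sqrt_lt' one_pos]
      linarith
    have hs1' : |√t| < 1 := by rwa [abs_of_pos hs]
    have hsq : √t ^ 2 = t := Real.sq_sqrt ht.le
  · have h := hasSum_sum (s := Finset.HasAntidiagonal.antidiagonal n) fun x _ =>
      (hasSum_cosCoeff x.2 hs1').mul_left (sincCoeff x.1)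
    rw [hsq] at h
    refine h.congr_fun fun m => ?_
    rw [Finset.sum_mul]
    exact Finset.sum_congr rfl fun x _ => by ring
  · simp only [sum_sincCoeff_mul_cosCoeff n hs hs1]
    have h1 := hasSum_sincCoeff hs.ne'
    have h2 := hasSum_coshCoeff n hs1'
    rw [hsq] at h1 h2
    have h3 := (hasSum_pow_mul h1 h2).mul_left ((-1) ^ n)
    rw [mul_left_comm] at h3
    exact h3.congr_fun fun m => by ring

/-! ### Translation back to W and Z -/

/-- The depth 2m + 1 is odd, so W is minus a moment for every j, and the sum is a convolution with
the coefficients of sin(πx)/(πx). -/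
theorem sum_W_mul_Z (m p : ℕ) :
    ∑ j ∈ Finset.Icc 1 (p + 1), W (2 * j + 2 * (m + 1) - 3) (2 * (m + 1) - 1) * Z j (p + 1) =
      -∑ x ∈ Finset.HasAntidiagonal.antidiagonal p,
        sincCoeff x.1 * gdIntegral (2 * m) (2 * x.2) := by
  rw [Finset.Nat.antidiagonal_eq_map', Finset.sum_map, ← Finset.sum_neg_distrib,
    Finset.range_eq_Ico]
  refine Finset.sum_bij' (fun j _ => j - 1) (fun j _ => j + 1) ?_ ?_ ?_ ?_ ?_
  · intro j hj
    simp only [Finset.mem_Icc, Finset.mem_Ico] at *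
    omega
  · intro j hj
    simp only [Finset.mem_Icc, Finset.mem_Ico] at *
    omega
  · intro j hj
    simp only [Finset.mem_Icc] at *
    omega
  · intro j hj
    simp
  · intro j hj
    rw [Finset.mem_Icc] at hj
    obtain ⟨i, rfl⟩ := Nat.exists_eq_add_of_le' hj.1
    have h1 : 2 * (i + 1) + 2 * (m + 1) - 3 = 2 * m + 1 + 2 * i := by omega
    have h2 : 2 * (m + 1) - 1 = 2 * m + 1 := by omega
    rw [Z_eq_sincCoeff hj.2, h1, h2, W_eq_gdIntegral]
    change _ = -(sincCoeff (p - (i + 1 - 1)) * gdIntegral (2 * m) (2 * (i + 1 - 1)))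
    rw [Nat.add_sub_cancel, Nat.add_sub_add_right, Odd.neg_one_pow ⟨m, rfl⟩]
    ring

theorem barTPartial_converges {r k : ℕ} (κ : Fin (2 * r - 1) → ℕ) (hr : 0 < r)
    (hκ : κ ∈ indices k (2 * r - 1)) : Tendsto (barTPartial κ) atTop (𝓝 (barT κ)) := by
  obtain ⟨s, hs⟩ : ∃ s, 2 * r - 1 = s + 1 := ⟨2 * r - 2, by omega⟩
  revert κ
  rw [hs]
  intro κ hκ
  exact tendsto_barTPartial κ (mem_indices.1 hκ).1

end

end AltMTV

theorem theorem1p2 (m p : ℕ) (hm : 0 < m) (hp : 0 < p) :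
    -- every series that enters the identity converges
    (∀ j ∈ Finset.Icc 1 p, ∀ κ ∈ AltMTV.indices (2 * j + 2 * m - 3) (2 * m - 1),
      Tendsto (AltMTV.barTPartial κ) atTop (𝓝 (AltMTV.barT κ))) ∧
    (∀ j ∈ Finset.Icc 1 m, ∀ κ ∈ AltMTV.indices (2 * j + 2 * p - 3) (2 * p - 1),
      Tendsto (AltMTV.barTPartial κ) atTop (𝓝 (AltMTV.barT κ))) ∧
    -- the duality
    (-1 : ℝ) ^ m * ∑ j ∈ Finset.Icc 1 p,
        AltMTV.W (2 * j + 2 * m - 3) (2 * m - 1) * AltMTV.Z j p =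
      (-1 : ℝ) ^ p * ∑ j ∈ Finset.Icc 1 m,
        AltMTV.W (2 * j + 2 * p - 3) (2 * p - 1) * AltMTV.Z j m := by
  refine ⟨fun j _ κ hκ => AltMTV.barTPartial_converges κ hm hκ,
    fun j _ κ hκ => AltMTV.barTPartial_converges κ hp hκ, ?_⟩
  obtain ⟨m, rfl⟩ := Nat.exists_eq_add_of_le' hm
  obtain ⟨p, rfl⟩ := Nat.exists_eq_add_of_le' hp
  rw [AltMTV.sum_W_mul_Z, AltMTV.sum_W_mul_Z]
  have h := AltMTV.sum_sincCoeff_mul_gdIntegral m p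
  simp only [mul_left_comm _ ((-1 : ℝ) ^ m), ← Finset.mul_sum] at h
  rw [pow_succ, pow_succ]
  linear_combination h
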